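/- **Setting.** There are $m$ resources and $n$ products; $A=(a_{ij})$ is a matrix of nonnegative integers with columns $A^j$, $p\in\mathbb R^n$ are the prices, $c\in\mathbb Z_{\ge 0}^m$ is the initial inventory, $T>0$, $\lambda>0$ and $\gamma\ge 0$. Let $\mathcal X=\prod_i\{0,\dots,c_i\}$, and for $x\in\mathcal X$ let $\mathcal A(x)$ be the collection of all $S\subseteq\{1,\dots,n\}$ with $x\ge A^j$ for every $j\in S$. Customers arrive according to a Poisson process with rate $\lambda$; a customer who is offered $S$ buys product $j$ with probability $P_j(S)$ and nothing with probability $P_0(S)$, where $P_j(S)=0$ for $j\notin S\cup\{0\}$ and $\sum_{j\in S\cup\{0\}}P_j(S)=1$. Let $\boldsymbol\pi$ be an admissible randomized Markov policy: for each $(t,x)\in[0,T]\times\mathcal X$, $\boldsymbol\pi(\cdot\mid t,x)$ is a probability distribution supported on $\mathcal A(x)$, and it is continuous in $t$. A customer arriving at time $t$ is offered an assortment drawn from $\boldsymbol\pi(\cdot\mid t,X_{t-})$; action and choice are randomized independently of the arrivals and of the past. $N_t\in\mathbb Z_{\ge 0}^n$ counts the sales up to time $t$, and $X_t=c-AN_t$,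 so $X_0=c$. Let $\mathcal H(\boldsymbol\pi(\cdot\mid t,x))=-\sum_{S\in\mathcal A(x)}\boldsymbol\pi(S\mid t,x)\log\boldsymbol\pi(S\mid t,x)$, and let $$J(t,x;\boldsymbol\pi)=\mathbb E_{t,x}\Big[\int_{(t,T]}p^\top dN_s+\gamma\int_t^T\mathcal H(\boldsymbol\pi(\cdot\mid s,X_{s-}))\,ds\Big],$$ where $\mathbb E_{t,x}$ refers to the process started at time $t$ in state $x$. **Theorem.** For every $(t,x)\in[0,T]\times\mathcal X$ with $\mathbb P(X_t=x)>0$, $J(t,x;\boldsymbol\pi)$ is the conditional expectation, given $X_t=x$, of $\int_{(t,T]}p^\top dN_s+\gamma\int_t^T\mathcal H(\boldsymbol\pi(\cdot\mid s,X_{s-}))\,ds$ for the process $X$ started at time $0$ in state $c$. Let $v:[0,T]\times\mathcal X\to\mathbb R$ be continuously differentiable in $t\in[0,T]$ for each $x\in\mathcal X$, and consider the two conditions (a) $v(T,x)=0$ for all $x\in\mathcal X$; (b) for every bounded process $\xi$ that is predictable for the filtration generated by $X$ (in particular, $\xi_t\in\mathcal F^{X}_{t-}$), the random variable below is integrable and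 $$\mathbb E\Big[\int_0^T\xi_t\big\{dv(t,X_t)+p^\top dN_t+\gamma\,\mathcal H(\boldsymbol\pi(\cdot\mid t,X_{t-}))\,dt\big\}\Big]=0 .$$ 1. If $v(t,x)=J(t,x;\boldsymbol\pi)$ for all $(t,x)\in[0,T]\times\mathcal X$, then (a) and (b) hold. 2. Conversely, if $\mathbb P(X_t=x)>0$ for all $t\in(0,T)$ and $x\in\mathcal X$, then (a) and (b) imply $v(t,x)=J(t,x;\boldsymbol\pi)$ for all $(t,x)\in[0,T]\times\mathcal X$. 3. Without that assumption, (a) and (b) hold together if and only if (a) holds and $v(t,x)=J(t,x;\boldsymbol\pi)$ for all $(t,x)\in[0,T]\times\mathcal X$ with $\mathbb P(X_t=x)>0$. -/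

import Mathlib

open MeasureTheory ProbabilityTheory Set
open scoped NNReal

noncomputable section

/-- Data of a choice-based network revenue management problem with `m` resources and `n` products.
Product sets (assortments) are `Finset (Fin n)`; a customer's choice is an `Option (Fin n)`, where
`none` is the no-purchase option. -/
structure RevenueModel (m n : ℕ) where
  /-- `A i j` units of resource `i` are used by one unit of product `j`. -/
  A : Matrix (Fin m) (Fin n) ℕ
  /-- prices -/
  price : Fin n → ℝ
  /-- initial inventory -/
  c : Fin m → ℕ
  /-- selling horizon `[0, T]` -/
  T : ℝ
  T_pos : 0 < T
  /-- arrival rate of the customers -/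
  rate : ℝ
  rate_pos : 0 < rate
  /-- `P S j` is the probability that a customer who is offered `S` chooses `j`. -/
  P : Finset (Fin n) → Option (Fin n) → ℝ
  P_nonneg : ∀ S j, 0 ≤ P S j
  P_sum : ∀ S, ∑ j, P S j = 1
  P_of_notMem : ∀ S (j : Fin n), j ∉ S → P S (some j) = 0
  /-- temperature (weight of the entropy) -/
  temp : ℝ
  temp_nonneg : 0 ≤ temp

/-- Inverse transform sampling from the weights `p` on a finite type: the unit interval is cut into
consecutive intervals of lengths `p a` (in the order of a fixed enumeration), and the returned
element is the one whose interval contains `u`. If `u` is uniform on `[0, 1]` and `p` is a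
probability vector then the result has law `p`; the default value occurs only for `u ∉ [0, 1)`. -/
def sampleFrom {α : Type} [Fintype α] [Nonempty α] (p : α → ℝ) (u : ℝ) : α :=
  open Classical in
  if h : ∃ a, u ∈ Ico (∑ b with Fintype.equivFin α b < Fintype.equivFin α a, p b)
      (∑ b with Fintype.equivFin α b ≤ Fintype.equivFin α a, p b)
  then h.choose else Classical.arbitrary α

/-- The Lebesgue–Stieltjes integral `∫_{(0, T]} f dz` of `f` against a right-continuous path `z` of
bounded variation on `[0, T]` (outside `[0, T]` the path is frozen at its end values). -/
def stieltjesIntegral (T : ℝ) (hT : 0 ≤ T) (f z : ℝ → ℝ) : ℝ :=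
  open Classical in
  if h : BoundedVariationOn (fun t => z (projIcc 0 T hT t)) univ then
    VectorMeasure.integral (h.vectorMeasure.restrict (Ioc 0 T)) f (ContinuousLinearMap.lsmul ℝ ℝ)
  else 0

/-- The filtration `σ(X_s : s ≤ t)`, `t ≥ 0`, generated by a process `X` with values in a countable
discrete space. (The ambient σ-algebra plays no role for predictability, hence `⊤`.) -/
def generatedFiltration {Ω E : Type*} (X : ℝ≥0 → Ω → E) :
    Filtration ℝ≥0 (⊤ : MeasurableSpace Ω) where
  seq t := ⨆ s : Iic t, MeasurableSpace.comap (X s) ⊤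
  mono' := fun _ _ hst => iSup_le fun r =>
    le_iSup_of_le (⟨r.1, le_trans r.2 hst⟩ : Iic _) le_rfl
  le' := fun _ => le_top

namespace RevenueModel

variable {m n : ℕ} (M : RevenueModel m n)

/-- The state space `{0, …, c₁} × ⋯ × {0, …, c_m}` of inventory levels. -/
abbrev State : Type := (i : Fin m) → Fin (M.c i + 1)

/-- The state with full inventory `c`. -/
def full : M.State := fun i => Fin.last (M.c i)

/-- Inventory `x - A N` left from `x` after the sales `N`. (The subtraction truncates at `0`, but
under an admissible policy `A N ≤ x` holds almost surely.) -/
def deplete (x : M.State) (N : Fin n → ℕ) : M.State :=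
  fun i => ⟨x i - (M.A.mulVec N) i, lt_of_le_of_lt (Nat.sub_le _ _) (x i).2⟩

/-- `S` may be offered in state `x`, i.e. `x ≥ A^j` for all `j ∈ S`. -/
def Feasible (x : M.State) (S : Finset (Fin n)) : Prop :=
  ∀ j ∈ S, ∀ i, M.A i j ≤ (x i : ℕ)

/-- `π t x S` is the probability `π(S ∣ t, x)` of offering `S` at time `t` in state `x`. -/
abbrev Policy : Type := Icc (0 : ℝ) M.T → M.State → Finset (Fin n) → ℝ

/-- Admissible randomized Markov policies (continuity in time subsumes measurability). -/
structure IsAdmissible (π : M.Policy) : Prop where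
  nonneg : ∀ t x S, 0 ≤ π t x S
  sum_eq_one : ∀ t x, ∑ S, π t x S = 1
  eq_zero_of_not_feasible : ∀ t x S, ¬ M.Feasible x S → π t x S = 0
  continuous : ∀ x S, Continuous fun t => π t x S

/-- The entropy `-∑_{S ∈ 𝒜(x)} π(S) log π(S)` of a distribution on the actions in state `x`. -/
def entropy (x : M.State) (p : Finset (Fin n) → ℝ) : ℝ :=
  open Classical in ∑ S with M.Feasible x S, Real.negMulLog (p S)

/-- The point of `[0, T]` closest to `t`; it is `t` itself for `t ∈ [0, T]`. -/
def clock (t : ℝ) : Icc (0 : ℝ) M.T := projIcc 0 M.T M.T_pos.le t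

/-! ### The controlled process, driven by a sequence of marks

`z k = (e, u, w)` belongs to the `k`-th customer (`k = 0, 1, …`): `e` is the time between the
previous customer (or the starting time) and this one, `u` randomizes the firm's action and `w` the
customer's choice. The process starts at time `s` in state `x` and follows the policy `π`. -/

/-- Arrival time of the `k`-th customer. -/
def arrival (s : ℝ) (z : ℕ → ℝ × ℝ × ℝ) (k : ℕ) : ℝ :=
  s + ∑ i ∈ Finset.range (k + 1), (z i).1

/-- Choice of a customer who arrives at time `t` when the inventory is `x`: an assortment is drawn
from `π(· ∣ t, x)`, then the customer's choice is drawn from the choice probabilities. -/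
def choice (π : M.Policy) (t : ℝ) (x : M.State) (u w : ℝ) : Option (Fin n) :=
  sampleFrom (M.P (sampleFrom (π (M.clock t) x) u)) w

/-- Sales of each product to the first `k` customers. -/
def salesTo (π : M.Policy) (s : ℝ) (x : M.State) (z : ℕ → ℝ × ℝ × ℝ) : ℕ → Fin n → ℕ
  | 0 => 0
  | k + 1 => fun j => salesTo π s x z k j +
      if M.choice π (arrival s z k) (M.deplete x (salesTo π s x z k)) (z k).2.1 (z k).2.2 = some j
      then 1 else 0

/-- `N_t`: the sales of each product up to and including time `t`. -/
def sales (π : M.Policy) (s : ℝ) (x : M.State) (z : ℕ → ℝ × ℝ × ℝ) (t : ℝ) : Fin n → ℕ :=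
  M.salesTo π s x z {k | arrival s z k ≤ t}.ncard

/-- `X_t = x - A N_t`: the inventory at time `t`. -/
def state (π : M.Policy) (s : ℝ) (x : M.State) (z : ℕ → ℝ × ℝ × ℝ) (t : ℝ) : M.State :=
  M.deplete x (M.sales π s x z t)

/-- `X_{t-}`: the inventory left by the sales strictly before time `t`. -/
def stateLeft (π : M.Policy) (s : ℝ) (x : M.State) (z : ℕ → ℝ × ℝ × ℝ) (t : ℝ) : M.State :=
  M.deplete x (M.salesTo π s x z {k | arrival s z k < t}.ncard)

/-- `ℋ(π(· ∣ t, X_{t-}))` along the path. -/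
def entropyAt (π : M.Policy) (s : ℝ) (x : M.State) (z : ℕ → ℝ × ℝ × ℝ) (t : ℝ) : ℝ :=
  M.entropy (M.stateLeft π s x z t) (π (M.clock t) (M.stateLeft π s x z t))

/-- `pᵀ N_t`: the revenue up to time `t`. -/
def revenue (π : M.Policy) (s : ℝ) (x : M.State) (z : ℕ → ℝ × ℝ × ℝ) (t : ℝ) : ℝ :=
  ∑ j, M.price j * (M.sales π s x z t j : ℝ)

/-- `∫_{(t, T]} pᵀ dN_r + γ ∫_t^T ℋ(π(· ∣ r, X_{r-})) dr` along the path. -/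
def rewardToGo (π : M.Policy) (s : ℝ) (x : M.State) (z : ℕ → ℝ × ℝ × ℝ) (t : ℝ) : ℝ :=
  (M.revenue π s x z M.T - M.revenue π s x z t) +
    M.temp * ∫ r in t..M.T, M.entropyAt π s x z r

/-- `∫_{(0, T]} ξ_t {dv(t, X_t) + pᵀ dN_t + γ ℋ(π(· ∣ t, X_{t-})) dt}` along the path. -/
def tdIntegral (π : M.Policy) (s : ℝ) (x : M.State) (z : ℕ → ℝ × ℝ × ℝ)
    (v : ℝ → M.State → ℝ) (ξ : ℝ → ℝ) : ℝ :=
  stieltjesIntegral M.T M.T_pos.le ξ (fun t => v t (M.state π s x z t)) +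
    stieltjesIntegral M.T M.T_pos.le ξ (M.revenue π s x z) +
    M.temp * ∫ t in (0)..M.T, ξ t * M.entropyAt π s x z t

/-! ### Probability -/

variable {Ω : Type*} [MeasurableSpace Ω]

/-- The marks of the customers are independent and identically distributed; each consists of three
independent variables: an exponential waiting time with the arrival rate (so that the customers
arrive according to a Poisson process) and two uniform variables on `[0, 1]`. -/
structure IsDrivingNoise (μ : Measure Ω) (Z : ℕ → Ω → ℝ × ℝ × ℝ) : Prop where
  measurable : ∀ k, Measurable (Z k)
  indep : iIndepFun Z μ
  law : ∀ k, μ.map (Z k) = (expMeasure M.rate).prod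
    ((volume.restrict (Icc (0 : ℝ) 1)).prod (volume.restrict (Icc (0 : ℝ) 1)))

/-- The inventory process `X^π`, which starts at time `0` with the full inventory `c`. -/
def X (π : M.Policy) (Z : ℕ → Ω → ℝ × ℝ × ℝ) (t : ℝ) (ω : Ω) : M.State :=
  M.state π 0 M.full (fun k => Z k ω) t

/-- The value function `J(t, x; π)`: the expected reward to go of the process that starts at time
`t` in state `x`. -/
def J (μ : Measure Ω) (Z : ℕ → Ω → ℝ × ℝ × ℝ) (π : M.Policy) (t : ℝ) (x : M.State) : ℝ :=
  ∫ ω, M.rewardToGo π t x (fun k => Z k ω) t ∂μ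

/-- The natural filtration of `X^π`. -/
def stateFiltration (π : M.Policy) (Z : ℕ → Ω → ℝ × ℝ × ℝ) :
    Filtration ℝ≥0 (⊤ : MeasurableSpace Ω) :=
  generatedFiltration fun t ω => M.X π Z t ω

/-- Bounded test processes that are predictable for the natural filtration of `X^π`. -/
structure IsTestFunction (π : M.Policy) (Z : ℕ → Ω → ℝ × ℝ × ℝ) (ξ : ℝ≥0 → Ω → ℝ) : Prop where
  predictable : IsStronglyPredictable (M.stateFiltration π Z) ξ
  bounded : ∃ C, ∀ t ω, |ξ t ω| ≤ C

/-- The martingale orthogonality condition for `v`. -/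
def IsOrthogonal (μ : Measure Ω) (Z : ℕ → Ω → ℝ × ℝ × ℝ) (π : M.Policy)
    (v : ℝ → M.State → ℝ) : Prop :=
  ∀ ξ : ℝ≥0 → Ω → ℝ, M.IsTestFunction π Z ξ →
    Integrable (fun ω =>
      M.tdIntegral π 0 M.full (fun k => Z k ω) v fun t => ξ t.toNNReal ω) μ ∧
    ∫ ω, M.tdIntegral π 0 M.full (fun k => Z k ω) v (fun t => ξ t.toNNReal ω) ∂μ = 0

end RevenueModel

end

/-! The value function is identified through the backward equation. With time running backwards from
`T`, the linear system `∂_t w + λ 𝔼[change of w plus revenue at an arrival] + γ ℋ = 0`, `w(T, ·) = 0`,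
has a solution because it is triangular: a sale that changes the inventory strictly decreases it
(`RevenueModel.exists_backward_solution`).

For a `C¹` function `v`, the Stieltjes integral in the orthogonality condition is, along almost every
path, a sum over the customers plus a Lebesgue integral (`RevenueModel.tdIntegral_eq_pathIntegral`,
which rests on `stieltjesIntegral_eq`). A predictable test process is a function of the marks whose
value at a time up to the `k`-th arrival only depends on the customers before
(`RevenueModel.IsTestFunction.exists_isNonanticipating`). Since the `k`-th mark is independent of
those customers, it can be resampled, and the contribution of the `k`-th customer is compensated by
an integral over the time during which this customer is awaited. This is Fubini's theorem and the
compensation formula `integral_expMeasure_add` for one exponential waiting time, and it gives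
`RevenueModel.integral_arrivalTerm`. Summing over `k` yields Dynkin's formula
`RevenueModel.integral_pathIntegral_eq_zero`: the integral of `ξ` against
`dw(t, X_t) + pᵀ dN_t + γ ℋ dt` has mean zero. The number of customers up to `T` is integrable, by
the compensation formula with all customers counted, so that the interchange of sum and expectation is
justified and almost all paths have finitely many arrivals.

With the test process `1` on `(t, T]` for the process started in `(t, x)` this says `w = J`
(`RevenueModel.J_eq`). For the process started in `(0, c)`, it says that `w` satisfies the
orthogonality condition, and for any `v` with this condition and `v(T, ·) = 0` the test process
`1_{r > t} 1_{X_t = x}` gives `v(t, x) ℙ(X_t = x) = 𝔼[reward to go; X_t = x]`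
(`RevenueModel.IsOrthogonal.setIntegral_rewardToGo`). With `v = w` this is the claim on the
conditional expectation, and in general it forces `v = w` at all states visited with positive
probability. Conversely, if `v = w` at these states then `v(t, X_t) = w(t, X_t)` for all `t` almost surely, by
right-continuity of the paths (`RevenueModel.ae_apply_X_eq`), so that the orthogonality condition
passes from `w` to `v`. -/

noncomputable section

/-! ### Inverse transform sampling -/

section Sampling

variable {α : Type} [Fintype α]

/-- The left end of the interval of `a` in inverse transform sampling from the weights `p`. -/
def lowerCut (p : α → ℝ) (a : α) : ℝ :=
  open Classical in ∑ b with Fintype.equivFin α b < Fintype.equivFin α a, p b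

/-- The right end of the interval of `a` in inverse transform sampling from the weights `p`. -/
def upperCut (p : α → ℝ) (a : α) : ℝ :=
  open Classical in ∑ b with Fintype.equivFin α b ≤ Fintype.equivFin α a, p b

lemma upperCut_eq (p : α → ℝ) (a : α) : upperCut p a = lowerCut p a + p a := by
  classical
  have : (Finset.univ.filter fun b => Fintype.equivFin α b ≤ Fintype.equivFin α a) =
      insert a (Finset.univ.filter fun b => Fintype.equivFin α b < Fintype.equivFin α a) := by
    ext b
    simp [le_iff_lt_or_eq, or_comm]
  unfold upperCut lowerCut
  rw [this, Finset.sum_insert (by simp)]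
  ring

lemma upperCut_le_lowerCut {p : α → ℝ} (hp : ∀ a, 0 ≤ p a) {a b : α}
    (h : Fintype.equivFin α a < Fintype.equivFin α b) : upperCut p a ≤ lowerCut p b := by
  classical
  refine Finset.sum_le_sum_of_subset_of_nonneg ?_ fun i _ _ => hp i
  intro c hc
  simp only [Finset.mem_filter, Finset.mem_univ, true_and] at hc ⊢
  exact hc.trans_lt h

variable [Nonempty α]

lemma sampleFrom_eq_of_mem {p : α → ℝ} (hp : ∀ a, 0 ≤ p a) {u : ℝ} {a : α}
    (hu : u ∈ Ico (lowerCut p a) (upperCut p a)) : sampleFrom p u = a := by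
  classical
  have h : ∃ a, u ∈ Ico (lowerCut p a) (upperCut p a) := ⟨a, hu⟩
  have hs : sampleFrom p u = h.choose := dif_pos h
  rw [hs]
  have h' := h.choose_spec
  rcases lt_trichotomy (Fintype.equivFin α h.choose) (Fintype.equivFin α a) with hlt | heq | hlt
  · exact absurd (h'.2.trans_le ((upperCut_le_lowerCut hp hlt).trans hu.1)) (lt_irrefl _)
  · exact (Fintype.equivFin α).injective heq
  · exact absurd (hu.2.trans_le ((upperCut_le_lowerCut hp hlt).trans h'.1)) (lt_irrefl _)

lemma sampleFrom_eq_iff {p : α → ℝ} (hp : ∀ a, 0 ≤ p a) {u : ℝ} {a : α} :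
    sampleFrom p u = a ↔ u ∈ Ico (lowerCut p a) (upperCut p a) ∨
      ((∀ b, u ∉ Ico (lowerCut p b) (upperCut p b)) ∧ Classical.arbitrary α = a) := by
  by_cases h : ∃ b, u ∈ Ico (lowerCut p b) (upperCut p b)
  · obtain ⟨b, hb⟩ := h
    rw [sampleFrom_eq_of_mem hp hb]
    constructor
    · rintro rfl
      exact Or.inl hb
    · rintro (h | h)
      · rw [← sampleFrom_eq_of_mem hp hb, sampleFrom_eq_of_mem hp h]
      · exact absurd hb (h.1 b)
  · have hs : sampleFrom p u = Classical.arbitrary α := dif_neg h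
    rw [hs]
    push Not at h
    constructor
    · exact fun h' => Or.inr ⟨h, h'⟩
    · rintro (h' | h')
      · exact absurd h' (h a)
      · exact h'.2

/-- The intervals cover `[0, 1)`. -/
lemma exists_mem_Ico_cut {p : α → ℝ} (hp1 : ∑ a, p a = 1) {u : ℝ}
    (hu : u ∈ Ico (0 : ℝ) 1) : ∃ a, u ∈ Ico (lowerCut p a) (upperCut p a) := by
  classical
  have hne : (Finset.univ.filter fun a => u < upperCut p a).Nonempty := by
    obtain ⟨a, -, ha⟩ := Finset.exists_max_image Finset.univ (Fintype.equivFin α)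
      Finset.univ_nonempty
    refine ⟨a, ?_⟩
    have : upperCut p a = 1 := by
      rw [← hp1, upperCut, Finset.filter_true_of_mem fun b _ => ha b (Finset.mem_univ _)]
    simp [this, hu.2]
  obtain ⟨a, ha, hmin⟩ := Finset.exists_min_image _ (Fintype.equivFin α) hne
  simp only [Finset.mem_filter, Finset.mem_univ, true_and] at ha hmin
  refine ⟨a, ?_, ha⟩
  rcases (Finset.univ.filter
    fun b => Fintype.equivFin α b < Fintype.equivFin α a).eq_empty_or_nonempty with he | hne'
  · rw [lowerCut, he]
    simpa using hu.1
  · -- the interval of the predecessor `b` of `a` ends where that of `a` starts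
    obtain ⟨b, hb, hmax⟩ := Finset.exists_max_image _ (Fintype.equivFin α) hne'
    simp only [Finset.mem_filter, Finset.mem_univ, true_and] at hb hmax
    have : lowerCut p a = upperCut p b := by
      unfold lowerCut upperCut
      congr 1
      ext c
      simp only [Finset.mem_filter, Finset.mem_univ, true_and]
      exact ⟨fun h => hmax c h, fun h => h.trans_lt hb⟩
    rw [this]
    by_contra! hlt
    exact absurd (hmin b hlt) (not_le.2 hb)

/-- Inverse transform sampling from a probability vector has the right law. -/
lemma integral_sampleFrom {p : α → ℝ} (hp : ∀ a, 0 ≤ p a) (hp1 : ∑ a, p a = 1) (f : α → ℝ) :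
    ∫ u in Icc (0 : ℝ) 1, f (sampleFrom p u) = ∑ a, p a * f a := by
  classical
  have hsum : ∀ u ∈ Ico (0 : ℝ) 1, f (sampleFrom p u) =
      ∑ a, (Ico (lowerCut p a) (upperCut p a)).indicator (fun _ => f a) u := by
    intro u hu
    obtain ⟨a, ha⟩ := exists_mem_Ico_cut hp1 hu
    rw [Finset.sum_eq_single a, indicator_of_mem ha, sampleFrom_eq_of_mem hp ha]
    · intro b _ hb
      refine indicator_of_notMem (fun hb' => hb ?_) _
      rw [← sampleFrom_eq_of_mem hp hb', sampleFrom_eq_of_mem hp ha]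
    · simp
  have hsub : ∀ a, Ico (lowerCut p a) (upperCut p a) ⊆ Ico 0 1 := by
    intro a
    refine Ico_subset_Ico (Finset.sum_nonneg fun i _ => hp i) ?_
    rw [← hp1]
    exact Finset.sum_le_sum_of_subset_of_nonneg (Finset.subset_univ _) fun i _ _ => hp i
  rw [integral_Icc_eq_integral_Ico, setIntegral_congr_fun measurableSet_Ico hsum,
    integral_finsetSum]
  · refine Finset.sum_congr rfl fun a _ => ?_
    rw [setIntegral_indicator measurableSet_Ico, inter_eq_self_of_subset_right (hsub a)]
    simp [upperCut_eq, hp a]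
  · intro a _
    exact (integrable_const _).indicator measurableSet_Ico

lemma measurableSet_sampleFrom_eq {β : Type*} [MeasurableSpace β] {p : β → α → ℝ}
    (hp : ∀ b a, 0 ≤ p b a) (hpm : ∀ a, Measurable fun b => p b a) {u : β → ℝ}
    (hu : Measurable u) (a : α) : MeasurableSet {b | sampleFrom (p b) (u b) = a} := by
  have hL : ∀ a, Measurable fun b => lowerCut (p b) a := fun a =>
    Finset.measurable_sum _ fun i _ => hpm i
  have hU : ∀ a, Measurable fun b => upperCut (p b) a := fun a =>
    Finset.measurable_sum _ fun i _ => hpm i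
  have hI : ∀ a, MeasurableSet {b | u b ∈ Ico (lowerCut (p b) a) (upperCut (p b) a)} := fun a =>
    (measurableSet_le (hL a) hu).inter (measurableSet_lt hu (hU a))
  have : {b | sampleFrom (p b) (u b) = a} =
      {b | u b ∈ Ico (lowerCut (p b) a) (upperCut (p b) a)} ∪
        ((⋂ c, {b | u b ∈ Ico (lowerCut (p b) c) (upperCut (p b) c)}ᶜ) ∩
          {_b | Classical.arbitrary α = a}) := by
    ext b
    simp [sampleFrom_eq_iff (hp b)]
  rw [this]
  exact (hI a).union ((MeasurableSet.iInter fun c => (hI c).compl).inter (.const _))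

end Sampling

/-! ### The Stieltjes integral of a path with finitely many jumps -/

section Stieltjes

lemma boundedVariationOn_of_abs_sub_le {f g : ℝ → ℝ} {s : Set ℝ} (hg : BoundedVariationOn g s)
    (h : ∀ a b, a ≤ b → |f b - f a| ≤ |g b - g a|) : BoundedVariationOn f s := by
  refine ne_top_of_le_ne_top hg ?_
  unfold eVariationOn
  refine iSup_mono fun p => Finset.sum_le_sum fun i _ => ?_
  rw [edist_dist, edist_dist, Real.dist_eq, Real.dist_eq]
  exact ENNReal.ofReal_le_ofReal (h _ _ (p.2.2.1 (Nat.le_succ i)))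

lemma integral_withDensityᵥ_real {X : Type*} [MeasurableSpace X] {μ : Measure X} [IsFiniteMeasure μ]
    {f d : X → ℝ} {C : ℝ} (hf : Measurable f) (hC : ∀ x, |f x| ≤ C) (hdm : Measurable d)
    (hd : Integrable d μ) :
    (μ.withDensityᵥ d).Integrable f ∧
      VectorMeasure.integral (μ.withDensityᵥ d) f (ContinuousLinearMap.lsmul ℝ ℝ) =
        ∫ x, f x * d x ∂μ := by
  have hflip : (ContinuousLinearMap.lsmul ℝ ℝ : ℝ →L[ℝ] ℝ →L[ℝ] ℝ) =
      (ContinuousLinearMap.lsmul ℝ ℝ).flip := by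
    ext
    simp
  have fin : ∀ e : X → ℝ, Integrable e μ →
      IsFiniteMeasure (μ.withDensity fun x => ENNReal.ofReal (e x)) := fun e he =>
    isFiniteMeasure_withDensity_ofReal he.2
  have hint : ∀ ν : Measure X, IsFiniteMeasure ν → Integrable f ν := fun ν _ =>
    Integrable.of_bound hf.aestronglyMeasurable C (ae_of_all _ hC)
  have key : ∀ e : X → ℝ, Measurable e →
      ∫ x, f x ∂(μ.withDensity fun x => ENNReal.ofReal (e x)) = ∫ x, max (e x) 0 * f x ∂μ := by
    intro e he
    rw [integral_withDensity_eq_integral_toReal_smul he.ennreal_ofReal (by simp)]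
    simp [ENNReal.toReal_ofReal']
  have := fin d hd
  have := fin (fun x => -d x) hd.neg
  rw [withDensityᵥ_eq_withDensity_pos_part_sub_withDensity_neg_part hd]
  have i1 : ((μ.withDensity fun x => ENNReal.ofReal (d x)).toSignedMeasure).Integrable f := by
    rw [VectorMeasure.Integrable, Measure.variation_toSignedMeasure]
    exact hint _ inferInstance
  have i2 : ((μ.withDensity fun x => ENNReal.ofReal (-d x)).toSignedMeasure).Integrable f := by
    rw [VectorMeasure.Integrable, Measure.variation_toSignedMeasure]
    exact hint _ inferInstance
  refine ⟨i1.sub_vectorMeasure i2, ?_⟩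
  rw [VectorMeasure.integral_sub_vectorMeasure i1 i2, hflip,
    VectorMeasure.integral_toSignedMeasure, VectorMeasure.integral_toSignedMeasure,
    key d hdm, key (fun x => -d x) hdm.neg, ← integral_sub]
  · refine integral_congr_ae (ae_of_all _ fun x => ?_)
    have : d x = max (d x) 0 - max (-d x) 0 := by
      rcases le_total 0 (d x) with h | h <;> simp [h]
    simp only []
    conv_rhs => rw [this]
    ring
  · exact hd.pos_part.mul_bdd hf.aestronglyMeasurable (ae_of_all _ hC)
  · exact hd.neg_part.mul_bdd hf.aestronglyMeasurable (ae_of_all _ hC)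

lemma sum_filter_le_eq_add {ι : Type*} (F : Finset ι) (τ δ : ι → ℝ) {a b : ℝ} (hab : a ≤ b) :
    ∑ k ∈ F with τ k ≤ b, δ k =
      ∑ k ∈ F with τ k ≤ a, δ k + ∑ k ∈ F with τ k ∈ Ioc a b, δ k := by
  classical
  rw [← Finset.sum_union]
  · congr 1
    ext k
    simp only [Finset.mem_filter, Finset.mem_union, mem_Ioc]
    constructor
    · rintro ⟨h1, h2⟩
      rcases le_or_gt (τ k) a with h | h
      · exact Or.inl ⟨h1, h⟩
      · exact Or.inr ⟨h1, h, h2⟩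
    · rintro (⟨h1, h2⟩ | ⟨h1, h2, h3⟩)
      · exact ⟨h1, h2.trans hab⟩
      · exact ⟨h1, h3⟩
  · exact Finset.disjoint_filter.2 fun k _ h1 h2 => absurd h1 (not_le.2 h2.1)

/-- The Stieltjes integral against a path that has a density `d` apart from finitely many jumps, of
heights `δ k` at the times `τ k`. -/
theorem stieltjesIntegral_eq {ι : Type*} {T : ℝ} (hT : 0 ≤ T) {f g d : ℝ → ℝ} {C : ℝ}
    (hf : Measurable f) (hC : ∀ t, |f t| ≤ C) (hdm : Measurable d)
    (hd : IntegrableOn d (Ioc 0 T)) (F : Finset ι) (τ δ : ι → ℝ) (hτ : ∀ k ∈ F, τ k ∈ Ioc 0 T)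
    (hg : ∀ t ∈ Icc 0 T, g t = g 0 + (∫ r in 0..t, d r) + ∑ k ∈ F with τ k ≤ t, δ k) :
    stieltjesIntegral T hT f g = (∫ t in 0..T, f t * d t) + ∑ k ∈ F, f (τ k) * δ k := by
  classical
  set G : ℝ → ℝ := fun t => g (projIcc 0 T hT t) with hG
  have hGI : ∀ t ∈ Icc 0 T, G t = g t := fun t ht => by simp [hG, projIcc_of_mem hT ht]
  have hii : ∀ a b, a ∈ Icc 0 T → b ∈ Icc 0 T → IntervalIntegrable d volume a b := by
    intro a b ha hb
    have h0 : IntervalIntegrable d volume 0 T :=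
      (intervalIntegrable_iff_integrableOn_Ioc_of_le hT).2 hd
    refine h0.mono_set ?_
    rw [uIcc_of_le hT]
    exact uIcc_subset_Icc ha hb
  -- increments of the path
  have hinc : ∀ a b, a ∈ Icc 0 T → b ∈ Icc 0 T → a ≤ b →
      g b - g a = (∫ r in a..b, d r) + ∑ k ∈ F with τ k ∈ Ioc a b, δ k := by
    intro a b ha hb hab
    rw [hg b hb, hg a ha, ← intervalIntegral.integral_add_adjacent_intervals
      (hii 0 a ⟨le_rfl, hT⟩ ha) (hii a b ha hb)]
    rw [sum_filter_le_eq_add F τ δ hab]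
    ring
  -- a monotone function that dominates the increments
  have hbv : BoundedVariationOn G univ := by
    set V : ℝ → ℝ := fun t => (∫ r in 0..(projIcc 0 T hT t : ℝ), |d r|) +
      ∑ k ∈ F with τ k ≤ (projIcc 0 T hT t : ℝ), |δ k| with hV
    have hVinc : ∀ a b, a ≤ b → |G b - G a| ≤ V b - V a := by
      intro a b hab
      have hp : (projIcc 0 T hT a : ℝ) ≤ projIcc 0 T hT b := monotone_projIcc hT hab
      have ha := (projIcc 0 T hT a).2
      have hb := (projIcc 0 T hT b).2
      set a' : ℝ := (projIcc 0 T hT a : ℝ)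
      set b' : ℝ := (projIcc 0 T hT b : ℝ)
      have e1 : V b - V a = (∫ r in a'..b', |d r|) + ∑ k ∈ F with τ k ∈ Ioc a' b', |δ k| := by
        change (∫ r in 0..b', |d r|) + _ - ((∫ r in 0..a', |d r|) + _) = _
        rw [sum_filter_le_eq_add F τ (fun k => |δ k|) hp,
          ← intervalIntegral.integral_add_adjacent_intervals
          (hii 0 a' ⟨le_rfl, hT⟩ ha).abs (hii a' b' ha hb).abs]
        ring
      rw [e1]
      refine (congrArg abs (hinc a' b' ha hb hp)).le.trans ((abs_add_le _ _).trans ?_)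
      exact add_le_add (intervalIntegral.abs_integral_le_integral_abs hp)
        (Finset.abs_sum_le_sum_abs _ _)
    have hVm : Monotone V := fun a b hab => by
      have := (abs_nonneg _).trans (hVinc a b hab)
      linarith
    refine boundedVariationOn_of_abs_sub_le (g := V) ?_ fun a b hab =>
      (hVinc a b hab).trans (le_abs_self _)
    refine (hVm.monotoneOn univ).boundedVariationOn (C := V T) fun t _ => ?_
    have h0 : V 0 ≤ V t := by
      rcases le_total 0 t with h | h
      · exact hVm h
      · simp [hV, projIcc_of_le_left hT h]
    have h1 : V t ≤ V T := by
      rcases le_total t T with h | h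
      · exact hVm h
      · simp [hV, projIcc_of_right_le hT h]
    have h2 : 0 ≤ V 0 := by
      simp only [hV, projIcc_left, intervalIntegral.integral_same, zero_add]
      exact Finset.sum_nonneg fun _ _ => abs_nonneg _
    rw [abs_of_nonneg (h2.trans h0)]
    exact h1
  -- right-continuity
  have hright : ∀ a ∈ Icc 0 T, G.rightLim a = g a := by
    intro a ha
    rw [← hGI a ha]
    refine ContinuousWithinAt.rightLim_eq (continuousWithinAt_Ioi_iff_Ici.1 ?_)
    rcases ha.2.eq_or_lt with rfl | haT
    · refine ContinuousWithinAt.congr (f := fun _ => G a) continuousWithinAt_const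
        (fun y hy => ?_) rfl
      simp [hG, projIcc_of_right_le hT (le_of_lt (show a < y from hy))]
    · have hev : ∀ᶠ t in nhdsWithin a (Ioi a), G t = g a + ∫ r in a..t, d r := by
        have hlt : ∀ k ∈ F, ∀ᶠ t in nhdsWithin a (Ioi a), τ k ∉ Ioc a t := by
          intro k _
          rcases le_or_gt (τ k) a with h | h
          · exact .of_forall fun t h' => absurd h (not_le.2 h'.1)
          · filter_upwards [Ioo_mem_nhdsGT h] with t ht h'
            exact absurd h'.2 (not_le.2 ht.2)
        filter_upwards [(Filter.eventually_all_finset F).2 hlt, Ioo_mem_nhdsGT haT] with t ht htT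
        have htI : t ∈ Icc 0 T := ⟨ha.1.trans htT.1.le, htT.2.le⟩
        have := hinc a t ha htI htT.1.le
        rw [Finset.filter_false_of_mem ht, Finset.sum_empty, add_zero] at this
        rw [hGI t htI, ← this]
        ring
      have hcont : ContinuousWithinAt (fun t => g a + ∫ r in a..t, d r) (Ioi a) a := by
        have hc : ContinuousOn (fun t => ∫ r in a..t, d r) (uIcc a T) :=
          intervalIntegral.continuousOn_primitive_interval'
            (hii a T ha ⟨hT, le_rfl⟩) left_mem_uIcc
        have hc' := (hc a left_mem_uIcc).const_add (g a)
        rw [uIcc_of_le ha.2] at hc'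
        have : ContinuousWithinAt (fun t => g a + ∫ r in a..t, d r) (Ioc a T) a :=
          hc'.mono Ioc_subset_Icc_self
        rwa [continuousWithinAt_Ioc_iff_Ioi haT] at this
      refine hcont.congr_of_eventuallyEq hev ?_
      simp [hGI a ha]
  -- the measure of the path
  set μ := (volume : Measure ℝ).restrict (Ioc 0 T) with hμ
  set ν : VectorMeasure ℝ ℝ := μ.withDensityᵥ d + ∑ k ∈ F, VectorMeasure.dirac (τ k) (δ k) with hν
  have hνa : ∀ s, MeasurableSet s → ν s = (∫ r in s ∩ Ioc 0 T, d r) + ∑ k ∈ F with τ k ∈ s, δ k := by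
    intro s hs
    have : ∀ k, VectorMeasure.dirac (τ k) (δ k) s = if τ k ∈ s then δ k else 0 := by
      intro k
      split_ifs with h
      · exact VectorMeasure.dirac_apply_of_mem hs h
      · exact VectorMeasure.dirac_apply_of_notMem h
    have hsum : ∀ F' : Finset ι, (∑ k ∈ F', VectorMeasure.dirac (τ k) (δ k)) s =
        ∑ k ∈ F', VectorMeasure.dirac (τ k) (δ k) s := by
      intro F'
      induction F' using Finset.induction_on with
      | empty => simp
      | insert k F' hk ih => rw [Finset.sum_insert hk, Finset.sum_insert hk, ← ih]; rfl
    calc ν s = μ.withDensityᵥ d s + (∑ k ∈ F, VectorMeasure.dirac (τ k) (δ k)) s := rfl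
      _ = _ := by
        rw [hsum, withDensityᵥ_apply hd hs, Measure.restrict_restrict hs, Finset.sum_filter]
        simp_rw [this]
  have hmeas : ∀ a b, a ∈ Icc 0 T → b ∈ Icc 0 T → a ≤ b →
      hbv.vectorMeasure (Ioc a b) = (∫ r in Ioc a b, d r) + ∑ k ∈ F with τ k ∈ Ioc a b, δ k := by
    intro a b ha hb hab
    rw [hbv.vectorMeasure_Ioc hab, hright a ha, hright b hb, hinc a b ha hb hab,
      intervalIntegral.integral_of_le hab]
  have heq : hbv.vectorMeasure.restrict (Ioc 0 T) = ν := by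
    have main : ∀ s a b, MeasurableSet s → a ∈ Icc 0 T → b ∈ Icc 0 T → a ≤ b →
        s ∩ Ioc 0 T = Ioc a b → hbv.vectorMeasure.restrict (Ioc 0 T) s = ν s := by
      intro s a b hs ha hb hab h
      rw [VectorMeasure.restrict_apply _ measurableSet_Ioc hs, hνa s hs, h, hmeas a b ha hb hab]
      congr 2
      refine Finset.filter_congr fun k hk => ?_
      rw [← h]
      simp only [mem_inter_iff, hτ k hk, and_true]
    refine VectorMeasure.ext_of_generateFrom {S | ∃ l u, l ≤ u ∧ Ioc l u = S} ?_ ?_ ?_ ?_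
    · rintro _ ⟨l, u, -, rfl⟩
      have hi : Ioc l u ∩ Ioc 0 T = Ioc (max l 0) (min u T) := Ioc_inter_Ioc
      rcases le_or_gt (max l 0) (min u T) with h | h
      · refine main _ _ _ measurableSet_Ioc ⟨le_max_right _ _, h.trans (min_le_right _ _)⟩
          ⟨(le_max_right l 0).trans h, min_le_right _ _⟩ h hi
      · refine main _ 0 0 measurableSet_Ioc ⟨le_rfl, hT⟩ ⟨le_rfl, hT⟩ le_rfl ?_
        rw [hi, Ioc_eq_empty (not_lt.2 h.le), Ioc_self]
    · have := borel_eq_generateFrom_Ioc_le ℝ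
      rwa [← BorelSpace.measurable_eq (α := ℝ)] at this
    · rintro _ ⟨l, u, -, rfl⟩ _ ⟨l', u', -, rfl⟩ hne
      rw [Ioc_inter_Ioc] at hne ⊢
      exact ⟨_, _, (nonempty_Ioc.1 hne).le, rfl⟩
    · exact main univ 0 T .univ ⟨le_rfl, hT⟩ ⟨hT, le_rfl⟩ hT (univ_inter _)
  have hdir : ∀ k, (VectorMeasure.dirac (τ k) (δ k)).Integrable f := by
    intro k
    rw [VectorMeasure.Integrable, VectorMeasure.variation_dirac]
    exact (Integrable.of_bound (μ := Measure.dirac (τ k)) hf.aestronglyMeasurable C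
      (ae_of_all _ hC)).smul_measure (by simp)
  obtain ⟨hi1, hi2⟩ := integral_withDensityᵥ_real (μ := μ) hf hC hdm hd
  rw [stieltjesIntegral, dif_pos hbv, heq, hν, VectorMeasure.integral_add_vectorMeasure hi1
    (VectorMeasure.Integrable.finsetSum_vectorMeasure fun k _ => hdir k), hi2,
    VectorMeasure.integral_finsetSum_vectorMeasure fun k _ => hdir k,
    intervalIntegral.integral_of_le hT]
  simp [hμ]

end Stieltjes

/-! ### The backward equation -/

/-- A scalar linear equation `u' = a u - b` has a solution that vanishes at `T`. -/
lemma exists_hasDerivAt_linear {a b : ℝ → ℝ} (ha : Continuous a) (hb : Continuous b) (T : ℝ) :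
    ∃ u : ℝ → ℝ, u T = 0 ∧ ∀ t, HasDerivAt u (a t * u t - b t) t := by
  set A : ℝ → ℝ := fun t => ∫ s in 0..t, a s
  have hA : ∀ t, HasDerivAt A (a t) t := fun t => ha.integral_hasStrictDerivAt 0 t |>.hasDerivAt
  have hAc : Continuous A := continuous_iff_continuousAt.2 fun t => (hA t).continuousAt
  have hc : Continuous fun s => Real.exp (-A s) * b s := (Real.continuous_exp.comp hAc.neg).mul hb
  refine ⟨fun t => -(Real.exp (A t) * ∫ s in T..t, Real.exp (-A s) * b s), by simp, fun t => ?_⟩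
  have h := ((hA t).exp.mul (hc.integral_hasStrictDerivAt T t).hasDerivAt).neg
  refine h.congr_deriv ?_
  have : Real.exp (A t) * Real.exp (-A t) = 1 := by rw [← Real.exp_add]; simp
  linear_combination (-b t) * this

namespace RevenueModel

variable {m n : ℕ} (M : RevenueModel m n)

/-- The inventory after a customer with choice `o` has been served. -/
def next (y : M.State) : Option (Fin n) → M.State
  | none => y
  | some j => M.deplete y (Pi.single j 1)

/-- The revenue from a customer with choice `o`. -/
def gain : Option (Fin n) → ℝ
  | none => 0
  | some j => M.price j

/-- The expectation of `φ` at the choice of a customer who arrives at time `t` in state `y`. -/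
def meanChoice (π : M.Policy) (t : ℝ) (y : M.State) (φ : Option (Fin n) → ℝ) : ℝ :=
  ∑ S, π (M.clock t) y S * ∑ o, M.P S o * φ o

/-- The entropy of the policy at time `t` in state `y`. -/
def entropyRate (π : M.Policy) (t : ℝ) (y : M.State) : ℝ := M.entropy y (π (M.clock t) y)

/-- The expected rate of change of `v(t, X_t)` plus the accumulated reward, when the process is in
state `y` at time `t` and `d` is the time derivative of `v`. -/
def drift (π : M.Policy) (v d : ℝ → M.State → ℝ) (t : ℝ) (y : M.State) : ℝ :=
  d t y + M.temp * M.entropyRate π t y +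
    M.rate * M.meanChoice π t y fun o => v t (M.next y o) - v t y + M.gain o

/-- `v` is continuously differentiable in time on `[0, T]`, with derivative `d`. The values of `d`
outside `[0, T]` only matter for its continuity. -/
structure HasTimeDeriv (v d : ℝ → M.State → ℝ) : Prop where
  continuous : ∀ y, Continuous fun t => d t y
  sub_eq : ∀ y, ∀ a ∈ Icc 0 M.T, ∀ b ∈ Icc 0 M.T, v b y - v a y = ∫ t in a..b, d t y

variable {M}

lemma continuous_clock : Continuous M.clock := continuous_projIcc (h := M.T_pos.le)

lemma clock_of_mem {t : ℝ} (ht : t ∈ Icc 0 M.T) : M.clock t = ⟨t, ht⟩ := projIcc_of_mem _ ht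

variable {π : M.Policy}

lemma continuous_entropyRate (hπ : M.IsAdmissible π) (y : M.State) :
    Continuous fun t => M.entropyRate π t y := by
  classical
  unfold entropyRate entropy
  exact continuous_finsetSum _ fun S _ =>
    Real.continuous_negMulLog.comp ((hπ.continuous y S).comp continuous_clock)

lemma continuous_meanChoice (hπ : M.IsAdmissible π) (y : M.State) {φ : ℝ → Option (Fin n) → ℝ}
    (hφ : ∀ o, Continuous fun t => φ t o) : Continuous fun t => M.meanChoice π t y (φ t) := by
  unfold meanChoice
  exact continuous_finsetSum _ fun S _ => ((hπ.continuous y S).comp continuous_clock).mul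
    (continuous_finsetSum _ fun o _ => continuous_const.mul (hφ o))

lemma meanChoice_add (t : ℝ) (y : M.State) (φ ψ : Option (Fin n) → ℝ) :
    M.meanChoice π t y (fun o => φ o + ψ o) = M.meanChoice π t y φ + M.meanChoice π t y ψ := by
  simp only [meanChoice, mul_add, Finset.sum_add_distrib]

lemma meanChoice_const_mul (t : ℝ) (y : M.State) (φ : Option (Fin n) → ℝ) (c : ℝ) :
    M.meanChoice π t y (fun o => c * φ o) = c * M.meanChoice π t y φ := by
  simp only [meanChoice, Finset.mul_sum]
  exact Finset.sum_congr rfl fun _ _ => Finset.sum_congr rfl fun _ _ => by ring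

lemma meanChoice_const (hπ : M.IsAdmissible π) (t : ℝ) (y : M.State) (c : ℝ) :
    M.meanChoice π t y (fun _ => c) = c := by
  simp [meanChoice, ← Finset.sum_mul, M.P_sum, hπ.sum_eq_one]

/-- The total inventory. -/
def size (y : M.State) : ℕ := ∑ i, (y i : ℕ)

lemma next_eq_or_size_lt (y : M.State) (o : Option (Fin n)) :
    M.next y o = y ∨ size (M.next y o) < size y := by
  have hle : ∀ i, (M.next y o i : ℕ) ≤ y i := by
    intro i
    cases o with
    | none => exact le_rfl
    | some j => exact Nat.sub_le _ _
  by_cases h : M.next y o = y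
  · exact Or.inl h
  · refine Or.inr (Finset.sum_lt_sum (fun i _ => hle i) ?_)
    by_contra! hge
    exact h (funext fun i => Fin.ext (le_antisymm (hle i) (hge i (Finset.mem_univ i))))

/-- The backward equation has a solution: sales never increase the inventory, so that the linear
system can be solved one state after the other, in the order of increasing total inventory. -/
theorem exists_backward_solution (hπ : M.IsAdmissible π) :
    ∃ w d : ℝ → M.State → ℝ, (∀ y, Continuous fun t => w t y) ∧ M.HasTimeDeriv w d ∧
      (∀ y, w M.T y = 0) ∧ ∀ t y, M.drift π w d t y = 0 := by
  classical
  obtain ⟨R, hR⟩ : ∃ R : (ℝ → M.State → ℝ) → ℝ → M.State → ℝ, ∀ w t y, R w t y =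
    -(M.temp * M.entropyRate π t y +
      M.rate * M.meanChoice π t y fun o => w t (M.next y o) - w t y + M.gain o) :=
    ⟨_, fun _ _ _ => rfl⟩
  -- a solution for the states with total inventory below `N`
  have main : ∀ N : ℕ, ∃ w : ℝ → M.State → ℝ, (∀ y, Continuous fun t => w t y) ∧
      (∀ y, w M.T y = 0) ∧ ∀ y, size y < N → ∀ t, HasDerivAt (fun t => w t y) (R w t y) t := by
    intro N
    induction N with
    | zero =>
      exact ⟨fun _ _ => 0, fun _ => continuous_const, fun _ => rfl, fun y hy => by simp at hy⟩
    | succ N ih =>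
      obtain ⟨w, hwc, hwT, hwd⟩ := ih
      obtain ⟨a, ha⟩ : ∃ a : M.State → ℝ → ℝ, ∀ y t, a y t =
        M.rate * M.meanChoice π t y fun o => if M.next y o = y then 0 else 1 := ⟨_, fun _ _ => rfl⟩
      obtain ⟨b, hb⟩ : ∃ b : M.State → ℝ → ℝ, ∀ y t, b y t =
        M.temp * M.entropyRate π t y + M.rate * M.meanChoice π t y fun o =>
          (if M.next y o = y then 0 else w t (M.next y o)) + M.gain o := ⟨_, fun _ _ => rfl⟩
      have hac : ∀ y, Continuous (a y) := fun y => by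
        rw [funext (ha y)]
        refine continuous_const.mul (continuous_meanChoice (M := M) hπ y
          (φ := fun _ o => if M.next y o = y then 0 else 1) fun o => continuous_const)
      have hbc : ∀ y, Continuous (b y) := fun y => by
        rw [funext (hb y)]
        refine (continuous_const.mul (continuous_entropyRate hπ y)).add
          (continuous_const.mul (continuous_meanChoice (M := M) hπ y (φ := fun t o =>
            (if M.next y o = y then 0 else w t (M.next y o)) + M.gain o) fun o => ?_))
        refine Continuous.add ?_ continuous_const
        split_ifs
        · exact continuous_const
        · exact hwc _
      choose u huT hud using fun y => exists_hasDerivAt_linear (hac y) (hbc y) M.T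
      refine ⟨fun t y => if size y = N then u y t else w t y, fun y => ?_, fun y => ?_, ?_⟩
      · by_cases h : size y = N
        · simp only [h, if_true]
          exact continuous_iff_continuousAt.2 fun t => (hud y t).continuousAt
        · simp only [h, if_false]
          exact hwc y
      · simp only [huT, hwT, ite_self]
      · intro y hy t
        have hnext : ∀ o, M.next y o = y ∨
            (M.next y o ≠ y ∧ size (M.next y o) < size y) := fun o => by
          rcases eq_or_ne (M.next y o) y with h | h
          · exact Or.inl h
          · exact Or.inr ⟨h, (next_eq_or_size_lt y o).resolve_left h⟩
        rcases eq_or_ne (size y) N with h | h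
        · simp only [h, if_true]
          refine (hud y t).congr_deriv ?_
          simp only [hR, ha, hb, h, if_true]
          have : (fun o => (if size (M.next y o) = N then u (M.next y o) t else w t (M.next y o)) -
              u y t + M.gain o) = fun o => (-u y t) * (if M.next y o = y then 0 else 1) +
              ((if M.next y o = y then 0 else w t (M.next y o)) + M.gain o) := by
            funext o
            rcases hnext o with h' | ⟨h', h''⟩
            · simp [h', h]
            · simp only [h', (h ▸ h'').ne, if_false]
              ring
          rw [this, meanChoice_add t y (fun o => -u y t * if M.next y o = y then 0 else 1),
            meanChoice_const_mul]
          ring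
        · have hlt : size y < N := lt_of_le_of_ne (Nat.lt_succ_iff.1 hy) h
          simp only [h, if_false]
          refine (hwd y hlt t).congr_deriv ?_
          simp only [hR, h, if_false]
          congr 4
          funext o
          have : size (M.next y o) ≠ N := by
            rcases hnext o with h' | ⟨-, h'⟩
            · rwa [h']
            · exact (h'.trans hlt).ne
          simp [this]
  obtain ⟨w, hwc, hwT, hwd⟩ := main ((∑ i, M.c i) + 1)
  have hsz : ∀ y : M.State, size y < (∑ i, M.c i) + 1 := fun y =>
    Nat.lt_succ_iff.2 (Finset.sum_le_sum fun i _ => Nat.lt_succ_iff.1 (y i).2)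
  have hRc : ∀ y, Continuous fun t => R w t y := fun y => by
    simp only [hR]
    exact ((continuous_const.mul (continuous_entropyRate hπ y)).add (continuous_const.mul
      (continuous_meanChoice (M := M) hπ y (φ := fun t o => w t (M.next y o) - w t y + M.gain o)
        fun o => ((hwc _).sub (hwc _)).add continuous_const))).neg
  refine ⟨w, R w, hwc, ⟨hRc, fun y a _ b _ => ?_⟩, hwT, fun t y => ?_⟩
  · rw [intervalIntegral.integral_eq_sub_of_hasDerivAt (fun t _ => hwd y (hsz y) t)
      ((hRc y).intervalIntegrable _ _)]
  · simp only [drift, hR]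
    ring

end RevenueModel

/-! ### Measurability of the controlled process in the marks -/

lemma measurable_ncard_setOf {β : Type*} [MeasurableSpace β] {p : β → ℕ → Prop}
    (hp : ∀ k, MeasurableSet {b | p b k}) : Measurable fun b => {k | p b k}.ncard := by
  classical
  have hF : ∀ F : Finset ℕ, MeasurableSet {b | {k | p b k} = F} := by
    intro F
    have : {b | {k | p b k} = (F : Set ℕ)} = ⋂ k, if k ∈ F then {b | p b k} else {b | p b k}ᶜ := by
      ext b
      simp only [mem_ofPred_eq, mem_iInter, Set.ext_iff, Finset.mem_coe]
      refine forall_congr' fun k => ?_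
      split_ifs with h <;> simp [h]
    rw [this]
    refine MeasurableSet.iInter fun k => ?_
    split_ifs
    · exact hp k
    · exact (hp k).compl
  refine measurable_to_countable' fun N => ?_
  have : (fun b => {k | p b k}.ncard) ⁻¹' {N} =
      (⋃ F : {F : Finset ℕ // F.card = N}, {b | {k | p b k} = F.1}) ∪
        ((⋂ F : Finset ℕ, {b | {k | p b k} = F}ᶜ) ∩ {_b | 0 = N}) := by
    ext b
    simp only [mem_preimage, mem_singleton_iff, mem_union, mem_iUnion, mem_ofPred_eq, mem_inter_iff,
      mem_iInter, mem_compl_iff, Subtype.exists, exists_prop]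
    by_cases hfin : {k | p b k}.Finite
    · obtain ⟨F, hFb⟩ : ∃ F : Finset ℕ, {k | p b k} = F := ⟨hfin.toFinset, by simp⟩
      rw [hFb, ncard_coe_finset]
      constructor
      · exact fun h => Or.inl ⟨F, h, rfl⟩
      · rintro (⟨F', h, h'⟩ | ⟨h, -⟩)
        · rwa [Finset.coe_injective h']
        · exact absurd rfl (h F)
    · have hne : ∀ F : Finset ℕ, {k | p b k} ≠ F := fun F h => hfin (h ▸ F.finite_toSet)
      rw [Infinite.ncard hfin]
      constructor
      · exact fun h => Or.inr ⟨hne, h⟩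
      · rintro (⟨F, -, h⟩ | ⟨-, h⟩)
        · exact absurd h (hne F)
        · exact h
  rw [this]
  exact (MeasurableSet.iUnion fun F => hF _).union
    ((MeasurableSet.iInter fun F => (hF F).compl).inter (.const _))

namespace RevenueModel

variable {m n : ℕ} {M : RevenueModel m n} {π : M.Policy}

lemma measurableSet_choice_eq (hπ : M.IsAdmissible π) {β : Type*} [MeasurableSpace β]
    {t u w : β → ℝ} (ht : Measurable t) (hu : Measurable u) (hw : Measurable w) (y : M.State)
    (o : Option (Fin n)) : MeasurableSet {b | M.choice π (t b) y (u b) (w b) = o} := by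
  have hS : ∀ S, MeasurableSet {b | sampleFrom (π (M.clock (t b)) y) (u b) = S} := fun S =>
    measurableSet_sampleFrom_eq (fun b S => hπ.nonneg _ _ _)
      (fun S => (((hπ.continuous y S).comp continuous_clock).measurable).comp ht) hu S
  have : {b | M.choice π (t b) y (u b) (w b) = o} = ⋃ S,
      {b | sampleFrom (π (M.clock (t b)) y) (u b) = S} ∩ {b | sampleFrom (M.P S) (w b) = o} := by
    ext b
    simp [choice]
  rw [this]
  exact MeasurableSet.iUnion fun S => (hS S).inter
    (measurableSet_sampleFrom_eq (fun _ => M.P_nonneg S) (fun _ => measurable_const) hw o)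

lemma measurable_comp_choice (hπ : M.IsAdmissible π) {β κ γ : Type*} [MeasurableSpace β]
    [MeasurableSpace κ] [Countable κ] [MeasurableSingletonClass κ] [MeasurableSpace γ]
    {t u w : β → ℝ} (ht : Measurable t) (hu : Measurable u) (hw : Measurable w)
    {N : β → κ} (hN : Measurable N) (y : κ → M.State) {f : β → κ → Option (Fin n) → γ}
    (hf : ∀ N o, Measurable fun b => f b N o) :
    Measurable fun b => f b (N b) (M.choice π (t b) (y (N b)) (u b) (w b)) := by
  intro S hS
  have : (fun b => f b (N b) (M.choice π (t b) (y (N b)) (u b) (w b))) ⁻¹' S =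
      ⋃ (N₀ : κ) (o : Option (Fin n)), (N ⁻¹' {N₀} ∩ {b | M.choice π (t b) (y N₀) (u b) (w b) = o}) ∩
        (fun b => f b N₀ o) ⁻¹' S := by
    ext b
    simp only [mem_preimage, mem_iUnion, mem_inter_iff, mem_singleton_iff, mem_ofPred_eq]
    constructor
    · exact fun h => ⟨_, _, ⟨rfl, rfl⟩, h⟩
    · rintro ⟨_, _, ⟨rfl, rfl⟩, h⟩
      exact h
  rw [this]
  exact MeasurableSet.iUnion fun N₀ => MeasurableSet.iUnion fun o =>
    ((hN (measurableSet_singleton _)).inter (measurableSet_choice_eq hπ ht hu hw _ o)).inter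
      (hf N₀ o hS)

lemma measurable_arrival (s : ℝ) (k : ℕ) : Measurable fun z => arrival s z k := by
  unfold arrival
  fun_prop

lemma measurable_salesTo (hπ : M.IsAdmissible π) (s : ℝ) (x : M.State) (k : ℕ) :
    Measurable fun z => M.salesTo π s x z k := by
  induction k with
  | zero => exact measurable_const
  | succ k ih =>
    refine measurable_pi_lambda _ fun j => ?_
    simp only [salesTo]
    exact measurable_comp_choice hπ (measurable_arrival s k)
      (u := fun z => (z k).2.1) (w := fun z => (z k).2.2) (by fun_prop) (by fun_prop) ih
      (M.deplete x) (f := fun _ N o => N j + if o = some j then 1 else 0)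
      fun _ _ => measurable_const

lemma measurable_deplete_salesTo (hπ : M.IsAdmissible π) (s : ℝ) (x : M.State)
    {c : ℝ × (ℕ → ℝ × ℝ × ℝ) → ℕ} (hc : Measurable c) :
    Measurable fun p : ℝ × (ℕ → ℝ × ℝ × ℝ) => M.deplete x (M.salesTo π s x p.2 (c p)) := by
  have h1 : Measurable fun q : ℕ × (ℕ → ℝ × ℝ × ℝ) => M.salesTo π s x q.2 q.1 :=
    measurable_from_prod_countable_right fun k => measurable_salesTo hπ s x k
  have h2 : Measurable (M.deplete x) := measurable_of_countable _
  exact h2.comp (h1.comp (hc.prodMk measurable_snd))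

lemma measurable_state (hπ : M.IsAdmissible π) (s : ℝ) (x : M.State) :
    Measurable fun p : ℝ × (ℕ → ℝ × ℝ × ℝ) => M.state π s x p.2 p.1 :=
  measurable_deplete_salesTo hπ s x (measurable_ncard_setOf fun k =>
    measurableSet_le ((measurable_arrival s k).comp measurable_snd) measurable_fst)

lemma measurable_stateLeft (hπ : M.IsAdmissible π) (s : ℝ) (x : M.State) :
    Measurable fun p : ℝ × (ℕ → ℝ × ℝ × ℝ) => M.stateLeft π s x p.2 p.1 :=
  measurable_deplete_salesTo hπ s x (measurable_ncard_setOf fun k =>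
    measurableSet_lt ((measurable_arrival s k).comp measurable_snd) measurable_fst)

lemma measurable_apply_state {β : Type*} [MeasurableSpace β] {g : ℝ → M.State → ℝ}
    (hg : ∀ y, Measurable fun t => g t y) {t : β → ℝ} (ht : Measurable t) {y : β → M.State}
    (hy : Measurable y) : Measurable fun b => g (t b) (y b) := by
  have : Measurable fun q : ℝ × M.State => g q.1 q.2 := measurable_from_prod_countable_left hg
  exact this.comp (ht.prodMk hy)

/-- A bound on `[0, T]` that is uniform in the state. -/
lemma exists_abs_le {g : ℝ → M.State → ℝ} (hg : ∀ y, ContinuousOn (fun t => g t y) (Icc 0 M.T)) :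
    ∃ C, 0 ≤ C ∧ ∀ t ∈ Icc 0 M.T, ∀ y, |g t y| ≤ C := by
  choose C hC using fun y => isCompact_Icc.exists_bound_of_continuousOn (hg y)
  refine ⟨∑ y, |C y|, Finset.sum_nonneg fun _ _ => abs_nonneg _, fun t ht y => ?_⟩
  exact ((hC y t ht).trans (le_abs_self _)).trans
    (Finset.single_le_sum (f := fun y => |C y|) (fun _ _ => abs_nonneg _) (Finset.mem_univ y))

end RevenueModel

/-! ### Paths of the controlled process -/

namespace RevenueModel

variable {m n : ℕ} (M : RevenueModel m n)

/-- The time from which the `k`-th customer is awaited: the arrival time of the customer before, or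
the starting time. -/
def epoch (s : ℝ) (z : ℕ → ℝ × ℝ × ℝ) (k : ℕ) : ℝ := s + ∑ i ∈ Finset.range k, (z i).1

/-- The inventory that the `k`-th customer meets. -/
def stock (π : M.Policy) (s : ℝ) (x : M.State) (z : ℕ → ℝ × ℝ × ℝ) (k : ℕ) : M.State :=
  M.deplete x (M.salesTo π s x z k)

/-- The choice of the `k`-th customer. -/
def choiceAt (π : M.Policy) (s : ℝ) (x : M.State) (z : ℕ → ℝ × ℝ × ℝ) (k : ℕ) :
    Option (Fin n) :=
  M.choice π (arrival s z k) (M.stock π s x z k) (z k).2.1 (z k).2.2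

/-- The change of `v(t, X_t) + pᵀ N_t` when a customer with choice `o` arrives at time `t` in
state `y`. -/
def jump (v : ℝ → M.State → ℝ) (t : ℝ) (y : M.State) (o : Option (Fin n)) : ℝ :=
  v t (M.next y o) - v t y + M.gain o

/-- The integral `∫_{(s, T]} ξ_t {dv(t, X_t) + pᵀ dN_t + γ ℋ dt}` along a path, written as a sum over
the customers plus a Lebesgue integral; `d` is the time derivative of `v`. -/
def pathIntegral (π : M.Policy) (s : ℝ) (x : M.State) (z : ℕ → ℝ × ℝ × ℝ)
    (v d : ℝ → M.State → ℝ) (ξ : ℝ → ℝ) : ℝ :=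
  (∑' k, if arrival s z k ≤ M.T then
    ξ (arrival s z k) * M.jump v (arrival s z k) (M.stock π s x z k) (M.choiceAt π s x z k) else 0) +
  ∫ t in s..M.T, ξ t * (d t (M.stateLeft π s x z t) +
    M.temp * M.entropyRate π t (M.stateLeft π s x z t))

/-- Waiting times are positive, and only finitely many customers arrive up to time `T`. -/
structure IsRegular (T s : ℝ) (z : ℕ → ℝ × ℝ × ℝ) : Prop where
  pos : ∀ k, 0 < (z k).1
  exists_lt : ∃ k, T < arrival s z k

variable {M} {π : M.Policy} {s : ℝ} {x : M.State} {z : ℕ → ℝ × ℝ × ℝ}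

lemma arrival_eq_add (k : ℕ) : arrival s z k = epoch s z k + (z k).1 := by
  simp only [arrival, epoch, Finset.sum_range_succ]
  ring

lemma strictMono_epoch (hz : ∀ k, 0 < (z k).1) : StrictMono (epoch s z) :=
  strictMono_nat_of_lt_succ fun k => by
    change epoch s z k < arrival s z k
    rw [arrival_eq_add]
    linarith [hz k]

lemma strictMono_arrival (hz : ∀ k, 0 < (z k).1) : StrictMono (arrival s z) := fun _ _ h =>
  strictMono_epoch hz (Nat.succ_lt_succ h)

lemma le_epoch (hz : ∀ k, 0 < (z k).1) (k : ℕ) : s ≤ epoch s z k := by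
  have h0 : epoch s z 0 = s := by simp [epoch]
  calc s = epoch s z 0 := h0.symm
    _ ≤ epoch s z k := (strictMono_epoch hz).monotone (Nat.zero_le k)

lemma lt_arrival (hz : ∀ k, 0 < (z k).1) (k : ℕ) : s < arrival s z k := by
  rw [arrival_eq_add]
  linarith [le_epoch (s := s) hz k, hz k]

lemma stock_zero : M.stock π s x z 0 = x := by
  funext i
  refine Fin.ext ?_
  simp [stock, deplete, salesTo]

lemma stock_succ (k : ℕ) :
    M.stock π s x z (k + 1) = M.next (M.stock π s x z k) (M.choiceAt π s x z k) := by
  rcases h : M.choiceAt π s x z k with _ | j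
  · have : M.salesTo π s x z (k + 1) = M.salesTo π s x z k := by
      funext j
      have h' : M.choice π (arrival s z k) (M.deplete x (M.salesTo π s x z k))
        (z k).2.1 (z k).2.2 = none := h
      simp [salesTo, h']
    simp [stock, this, next]
  · have : M.salesTo π s x z (k + 1) = M.salesTo π s x z k + Pi.single j 1 := by
      funext i
      have h' : M.choice π (arrival s z k) (M.deplete x (M.salesTo π s x z k))
        (z k).2.1 (z k).2.2 = some j := h
      simp [salesTo, h', Pi.single_apply, eq_comm]
    funext i
    refine Fin.ext ?_
    simp [stock, this, next, deplete, Matrix.mulVec_add, Nat.sub_sub]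

lemma sum_price_salesTo (k : ℕ) : ∑ j, M.price j * (M.salesTo π s x z k j : ℝ) =
    ∑ i ∈ Finset.range k, M.gain (M.choiceAt π s x z i) := by
  induction k with
  | zero => simp [salesTo]
  | succ k ih =>
    rw [Finset.sum_range_succ, ← ih]
    have hc : M.choice π (arrival s z k) (M.deplete x (M.salesTo π s x z k))
      (z k).2.1 (z k).2.2 = M.choiceAt π s x z k := rfl
    simp only [salesTo, hc, Nat.cast_add, mul_add, Finset.sum_add_distrib]
    congr 1
    rcases M.choiceAt π s x z k with _ | j <;> simp [gain]

lemma ncard_arrival_le {t : ℝ} {k : ℕ} (hz : ∀ k, 0 < (z k).1) (h1 : ∀ i < k, arrival s z i ≤ t)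
    (h2 : t < arrival s z k) : {i | arrival s z i ≤ t}.ncard = k := by
  have : {i | arrival s z i ≤ t} = Finset.range k := by
    ext i
    simp only [mem_ofPred_eq, Finset.coe_range, mem_Iio]
    refine ⟨fun h => ?_, h1 i⟩
    exact (strictMono_arrival hz).lt_iff_lt.1 (h.trans_lt h2)
  rw [this, ncard_coe_finset, Finset.card_range]

lemma ncard_arrival_lt {t : ℝ} {k : ℕ} (hz : ∀ k, 0 < (z k).1) (h1 : epoch s z k < t)
    (h2 : t ≤ arrival s z k) : {i | arrival s z i < t}.ncard = k := by
  have : {i | arrival s z i < t} = Finset.range k := by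
    ext i
    simp only [mem_ofPred_eq, Finset.coe_range, mem_Iio]
    refine ⟨fun h => (strictMono_arrival hz).lt_iff_lt.1 (h.trans_le h2), fun h => ?_⟩
    exact ((strictMono_epoch hz).monotone (Nat.succ_le_of_lt h)).trans_lt h1
  rw [this, ncard_coe_finset, Finset.card_range]

lemma stateLeft_eq_stock {t : ℝ} {k : ℕ} (hz : ∀ k, 0 < (z k).1) (h1 : epoch s z k < t)
    (h2 : t ≤ arrival s z k) : M.stateLeft π s x z t = M.stock π s x z k := by
  rw [stateLeft, ncard_arrival_lt hz h1 h2, stock]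

/-- The customers that have arrived up to time `t`. -/
lemma IsRegular.exists_count {T : ℝ} (hz : IsRegular T s z) {t : ℝ} (ht : t ≤ T) :
    ∃ c, {i | arrival s z i ≤ t}.ncard = c ∧ (∀ k, arrival s z k ≤ t ↔ k < c) ∧
      (s ≤ t → epoch s z c ≤ t) ∧ t < arrival s z c := by
  classical
  have hex : ∃ k, t < arrival s z k := hz.exists_lt.imp fun k h => ht.trans_lt h
  have h2 := Nat.find_spec hex
  have h1 : ∀ i < Nat.find hex, arrival s z i ≤ t := fun i hi => not_lt.1 (Nat.find_min hex hi)
  refine ⟨Nat.find hex, ncard_arrival_le hz.pos h1 h2, fun k => ⟨fun h => ?_, h1 k⟩, fun hst => ?_,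
    h2⟩
  · exact (strictMono_arrival hz.pos).lt_iff_lt.1 (h.trans_lt h2)
  · rcases h : Nat.find hex with _ | c
    · simpa [epoch] using hst
    · exact h1 c (by omega)

lemma integrableOn_stateLeft (hπ : M.IsAdmissible π) {g : ℝ → M.State → ℝ}
    (hg : ∀ y, Continuous fun t => g t y) :
    IntegrableOn (fun t => g t (M.stateLeft π s x z t)) (Icc 0 M.T) := by
  obtain ⟨C, -, hC⟩ := exists_abs_le (M := M) fun y => (hg y).continuousOn
  have hm : Measurable fun t => g t (M.stateLeft π s x z t) :=
    measurable_apply_state (fun y => (hg y).measurable) measurable_id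
      ((measurable_stateLeft hπ s x).comp measurable_prodMk_right)
  refine Integrable.of_bound hm.aestronglyMeasurable C ?_
  filter_upwards [ae_restrict_mem measurableSet_Icc] with t ht using hC t ht _

lemma intervalIntegrable_stateLeft (hπ : M.IsAdmissible π) {g : ℝ → M.State → ℝ}
    (hg : ∀ y, Continuous fun t => g t y) {a b : ℝ} (ha : a ∈ Icc 0 M.T) (hb : b ∈ Icc 0 M.T) :
    IntervalIntegrable (fun t => g t (M.stateLeft π s x z t)) volume a b :=
  ((integrableOn_stateLeft hπ hg).mono_set (uIcc_subset_Icc ha hb)).intervalIntegrable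

/-- The change of variables formula along a path, up to the `k`-th customer. -/
lemma apply_stock_eq (hπ : M.IsAdmissible π) {v d : ℝ → M.State → ℝ} (hv : M.HasTimeDeriv v d)
    (hs : 0 ≤ s) (hz : ∀ k, 0 < (z k).1) (k : ℕ) :
    ∀ t, epoch s z k ≤ t → t ≤ arrival s z k → t ≤ M.T →
      v t (M.stock π s x z k) = v s x + (∫ r in s..t, d r (M.stateLeft π s x z r)) +
        ∑ i ∈ Finset.range k, (v (arrival s z i) (M.stock π s x z (i + 1)) -
          v (arrival s z i) (M.stock π s x z i)) := by
  have step : ∀ k t, epoch s z k ≤ t → t ≤ arrival s z k → t ≤ M.T →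
      v t (M.stock π s x z k) = v (epoch s z k) (M.stock π s x z k) +
        ∫ r in epoch s z k..t, d r (M.stateLeft π s x z r) := by
    intro k t h1 h2 h3
    have he := hs.trans (le_epoch (s := s) hz k)
    rw [intervalIntegral.integral_congr_ae (g := fun r => d r (M.stock π s x z k))
      (ae_of_all _ fun r hr => ?_), ← hv.sub_eq _ _ ⟨he, h1.trans h3⟩ _ ⟨he.trans h1, h3⟩]
    · ring
    · rw [uIoc_of_le h1] at hr
      simp only [stateLeft_eq_stock hz hr.1 (hr.2.trans h2)]
  induction k with
  | zero =>
    intro t h1 h2 h3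
    have h := step 0 t h1 h2 h3
    have h0 : epoch s z 0 = s := by simp [epoch]
    rw [h0, stock_zero] at h
    simpa [stock_zero] using h
  | succ k ih =>
    intro t h1 h2 h3
    have hek : epoch s z k ≤ epoch s z (k + 1) := (strictMono_epoch hz).monotone k.le_succ
    have he : s ≤ epoch s z (k + 1) := le_epoch hz _
    have h := ih (epoch s z (k + 1)) hek le_rfl (h1.trans h3)
    rw [step (k + 1) t h1 h2 h3, Finset.sum_range_succ,
      ← intervalIntegral.integral_add_adjacent_intervals
      (b := epoch s z (k + 1)) (intervalIntegrable_stateLeft hπ hv.continuous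
        ⟨hs, he.trans (h1.trans h3)⟩ ⟨hs.trans he, h1.trans h3⟩)
      (intervalIntegrable_stateLeft hπ hv.continuous ⟨hs.trans he, h1.trans h3⟩
        ⟨(hs.trans he).trans h1, h3⟩)]
    change v (epoch s z (k + 1)) _ + _ =
      _ + (_ + (v (epoch s z (k + 1)) _ - v (epoch s z (k + 1)) _))
    rw [h]
    ring

lemma apply_state_eq (hπ : M.IsAdmissible π) {v d : ℝ → M.State → ℝ} (hv : M.HasTimeDeriv v d)
    (hs : 0 ≤ s) (hz : IsRegular M.T s z) {t : ℝ} (ht : t ∈ Icc s M.T) :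
    v t (M.state π s x z t) = v s x + (∫ r in s..t, d r (M.stateLeft π s x z r)) +
      ∑ i ∈ Finset.range ({i | arrival s z i ≤ t}.ncard), (v (arrival s z i)
        (M.stock π s x z (i + 1)) - v (arrival s z i) (M.stock π s x z i)) := by
  obtain ⟨c, hc, -, h1, h2⟩ := hz.exists_count ht.2
  have : M.state π s x z t = M.stock π s x z c := by rw [state, sales, hc, stock]
  rw [this, hc, apply_stock_eq hπ hv hs hz.pos c t (h1 ht.1) h2.le ht.2]

lemma revenue_eq (t : ℝ) : M.revenue π s x z t =
    ∑ i ∈ Finset.range ({i | arrival s z i ≤ t}.ncard), M.gain (M.choiceAt π s x z i) := by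
  rw [revenue, ← sum_price_salesTo]
  rfl

lemma pathIntegral_eq_sum (hz : IsRegular M.T s z) (v d : ℝ → M.State → ℝ) (ξ : ℝ → ℝ) :
    M.pathIntegral π s x z v d ξ =
      (∑ i ∈ Finset.range ({i | arrival s z i ≤ M.T}.ncard), ξ (arrival s z i) *
        M.jump v (arrival s z i) (M.stock π s x z i) (M.choiceAt π s x z i)) +
      ∫ t in s..M.T, ξ t * (d t (M.stateLeft π s x z t) +
        M.temp * M.entropyRate π t (M.stateLeft π s x z t)) := by
  obtain ⟨c, hc, h, -, -⟩ := hz.exists_count le_rfl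
  rw [pathIntegral, hc, tsum_eq_sum (s := Finset.range c)]
  · congr 1
    exact Finset.sum_congr rfl fun i hi => if_pos ((h i).2 (Finset.mem_range.1 hi))
  · intro i hi
    exact if_neg fun h' => hi (Finset.mem_range.2 ((h i).1 h'))

/-- Against the test function `c 1_{(t, T]}`, the path integral telescopes. -/
lemma pathIntegral_indicator (hπ : M.IsAdmissible π) {v d : ℝ → M.State → ℝ}
    (hv : M.HasTimeDeriv v d) (hs : 0 ≤ s) (hz : IsRegular M.T s z) {t : ℝ} (ht : t ∈ Icc s M.T)
    (c : ℝ) :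
    M.pathIntegral π s x z v d (fun r => if t < r then c else 0) =
      c * (v M.T (M.state π s x z M.T) - v t (M.state π s x z t) + M.rewardToGo π s x z t) := by
  have hsT : s ≤ M.T := ht.1.trans ht.2
  have hsI : s ∈ Icc 0 M.T := ⟨hs, hsT⟩
  have htI : t ∈ Icc 0 M.T := ⟨hs.trans ht.1, ht.2⟩
  have hTI : M.T ∈ Icc 0 M.T := ⟨M.T_pos.le, le_rfl⟩
  rw [pathIntegral_eq_sum hz, apply_state_eq hπ hv hs hz ht,
    apply_state_eq hπ hv hs hz ⟨hsT, le_rfl⟩, rewardToGo, revenue_eq, revenue_eq]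
  obtain ⟨K, hK, hK', -, -⟩ := hz.exists_count le_rfl
  obtain ⟨k, hk, hk', -, -⟩ := hz.exists_count ht.2
  rw [hK, hk]
  have hkK : k ≤ K := by
    by_contra! h
    exact absurd ((hK' K).1 (((hk' K).2 h).trans ht.2)) (lt_irrefl _)
  have hsum : ∑ i ∈ Finset.range K, (if t < arrival s z i then c else 0) *
      M.jump v (arrival s z i) (M.stock π s x z i) (M.choiceAt π s x z i) =
      c * (∑ i ∈ Finset.range K,
          M.jump v (arrival s z i) (M.stock π s x z i) (M.choiceAt π s x z i) -
        ∑ i ∈ Finset.range k,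
          M.jump v (arrival s z i) (M.stock π s x z i) (M.choiceAt π s x z i)) := by
    rw [← Finset.sum_range_add_sum_Ico _ hkK, ← Finset.sum_range_add_sum_Ico _ hkK,
      add_sub_cancel_left, Finset.mul_sum]
    have h0 : ∑ i ∈ Finset.range k, (if t < arrival s z i then c else 0) *
        M.jump v (arrival s z i) (M.stock π s x z i) (M.choiceAt π s x z i) = 0 :=
      Finset.sum_eq_zero fun i hi => by
        rw [if_neg (not_lt.2 ((hk' i).2 (Finset.mem_range.1 hi))), zero_mul]
    rw [h0, zero_add]
    refine Finset.sum_congr rfl fun i hi => ?_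
    rw [if_pos]
    by_contra! h
    exact absurd ((hk' i).1 h) (not_lt.2 (Finset.mem_Ico.1 hi).1)
  have hjump : ∀ N, ∑ i ∈ Finset.range N,
      M.jump v (arrival s z i) (M.stock π s x z i) (M.choiceAt π s x z i) =
      ∑ i ∈ Finset.range N, (v (arrival s z i) (M.stock π s x z (i + 1)) -
        v (arrival s z i) (M.stock π s x z i)) +
      ∑ i ∈ Finset.range N, M.gain (M.choiceAt π s x z i) := by
    intro N
    rw [← Finset.sum_add_distrib]
    exact Finset.sum_congr rfl fun i _ => by rw [jump, stock_succ]
  have hd : ∀ a b, a ∈ Icc 0 M.T → b ∈ Icc 0 M.T →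
      IntervalIntegrable (fun r => d r (M.stateLeft π s x z r)) volume a b := fun a b ha hb =>
    intervalIntegrable_stateLeft hπ hv.continuous ha hb
  have he : ∀ a b, a ∈ Icc 0 M.T → b ∈ Icc 0 M.T →
      IntervalIntegrable (fun r => M.entropyRate π r (M.stateLeft π s x z r)) volume a b :=
    fun a b ha hb => intervalIntegrable_stateLeft hπ (continuous_entropyRate hπ) ha hb
  have hint : ∫ r in s..M.T, (if t < r then c else 0) * (d r (M.stateLeft π s x z r) +
      M.temp * M.entropyRate π r (M.stateLeft π s x z r)) =
      c * ((∫ r in s..M.T, d r (M.stateLeft π s x z r)) -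
        (∫ r in s..t, d r (M.stateLeft π s x z r)) +
        M.temp * ∫ r in t..M.T, M.entropyAt π s x z r) := by
    have e1 : (∫ r in s..M.T, d r (M.stateLeft π s x z r)) -
        (∫ r in s..t, d r (M.stateLeft π s x z r)) = ∫ r in t..M.T, d r (M.stateLeft π s x z r) := by
      rw [← intervalIntegral.integral_add_adjacent_intervals (hd s t hsI htI) (hd t M.T htI hTI)]
      ring
    have e2 : ∫ r in t..M.T, M.entropyAt π s x z r =
      ∫ r in t..M.T, M.entropyRate π r (M.stateLeft π s x z r) := rfl
    rw [e1, e2, ← intervalIntegral.integral_const_mul, ← intervalIntegral.integral_add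
      (hd t M.T htI hTI) ((he t M.T htI hTI).const_mul _), ← intervalIntegral.integral_const_mul,
      intervalIntegral.integral_of_le hsT, intervalIntegral.integral_of_le ht.2]
    have : ∀ r, (if t < r then c else 0) * (d r (M.stateLeft π s x z r) +
        M.temp * M.entropyRate π r (M.stateLeft π s x z r)) = (Ioi t).indicator (fun r =>
          c * (d r (M.stateLeft π s x z r) +
            M.temp * M.entropyRate π r (M.stateLeft π s x z r))) r := by
      intro r
      by_cases h : t < r <;> simp [h, indicator]
    simp_rw [this]
    rw [setIntegral_indicator measurableSet_Ioi, Ioc_inter_Ioi, max_eq_right ht.1]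
  rw [hsum, hint, hjump K, hjump k]
  ring

/-- The Stieltjes integrals in the definition of `tdIntegral` are sums over the customers plus
Lebesgue integrals. -/
lemma tdIntegral_eq_pathIntegral (hπ : M.IsAdmissible π) {v d : ℝ → M.State → ℝ}
    (hv : M.HasTimeDeriv v d) (hz : IsRegular M.T 0 z) {ξ : ℝ → ℝ} (hξ : Measurable ξ) {C : ℝ}
    (hC : ∀ t, |ξ t| ≤ C) :
    M.tdIntegral π 0 x z v ξ = M.pathIntegral π 0 x z v d ξ := by
  have hT := M.T_pos.le
  obtain ⟨K, hK, hK', -, -⟩ := hz.exists_count le_rfl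
  have hτ : ∀ k ∈ Finset.range K, arrival 0 z k ∈ Ioc 0 M.T := fun k hk =>
    ⟨lt_arrival hz.pos k, (hK' k).2 (Finset.mem_range.1 hk)⟩
  have hfilter : ∀ t ≤ M.T, ∀ f : ℕ → ℝ, ∑ k ∈ Finset.range K with arrival 0 z k ≤ t, f k =
      ∑ k ∈ Finset.range ({i | arrival 0 z i ≤ t}.ncard), f k := by
    intro t ht f
    obtain ⟨c, hc, hc', -, -⟩ := hz.exists_count ht
    rw [hc]
    congr 1
    ext k
    simp only [Finset.mem_filter, Finset.mem_range, hc', ← hK']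
    exact ⟨fun h => h.2, fun h => ⟨((hc' k).2 h).trans ht, h⟩⟩
  have h00 : (0 : ℝ) ∈ Icc 0 M.T := ⟨le_rfl, hT⟩
  have hn0 : {i | arrival 0 z i ≤ 0}.ncard = 0 :=
    ncard_arrival_le hz.pos (fun i hi => absurd hi (Nat.not_lt_zero i)) (lt_arrival hz.pos 0)
  have hdm : Measurable fun t => d t (M.stateLeft π 0 x z t) :=
    measurable_apply_state (fun y => (hv.continuous y).measurable) measurable_id
      ((measurable_stateLeft hπ 0 x).comp measurable_prodMk_right)
  have hdi := integrableOn_stateLeft (s := 0) (x := x) (z := z) hπ hv.continuous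
  have hei := integrableOn_stateLeft (s := 0) (x := x) (z := z) hπ (continuous_entropyRate hπ)
  have h1 := stieltjesIntegral_eq hT hξ hC hdm (hdi.mono_set Ioc_subset_Icc_self)
    (Finset.range K) (arrival 0 z) (fun k => v (arrival 0 z k) (M.stock π 0 x z (k + 1)) -
      v (arrival 0 z k) (M.stock π 0 x z k)) hτ (g := fun t => v t (M.state π 0 x z t))
    fun t ht => by
      rw [hfilter t ht.2, apply_state_eq hπ hv le_rfl hz ht, apply_state_eq hπ hv le_rfl hz h00, hn0]
      simp
  have h2 := stieltjesIntegral_eq hT hξ hC (measurable_const (a := (0 : ℝ)))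
    (integrableOn_zero) (Finset.range K) (arrival 0 z) (fun k => M.gain (M.choiceAt π 0 x z k)) hτ
    (g := M.revenue π 0 x z) fun t ht => by
      rw [hfilter t ht.2, revenue_eq, revenue_eq, hn0]
      simp
  have e3 : ∫ t in (0)..M.T, ξ t * M.entropyAt π 0 x z t =
    ∫ t in (0)..M.T, ξ t * M.entropyRate π t (M.stateLeft π 0 x z t) := rfl
  have hi : ∀ f : ℝ → ℝ, IntegrableOn f (Icc 0 M.T) →
      IntervalIntegrable (fun t => ξ t * f t) volume 0 M.T := fun f hf => by
    rw [intervalIntegrable_iff_integrableOn_Icc_of_le hT]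
    exact hf.bdd_mul hξ.aestronglyMeasurable (ae_of_all _ hC)
  rw [tdIntegral, h1, h2, e3, pathIntegral_eq_sum hz, hK]
  simp only [mul_zero, intervalIntegral.integral_zero, zero_add, mul_add]
  have e4 : ∀ t, ξ t * (M.temp * M.entropyRate π t (M.stateLeft π 0 x z t)) =
    M.temp * (ξ t * M.entropyRate π t (M.stateLeft π 0 x z t)) := fun t => by ring
  simp_rw [e4]
  rw [intervalIntegral.integral_add (hi _ hdi) ((hi _ hei).const_mul _),
    intervalIntegral.integral_const_mul]
  have e5 : ∑ i ∈ Finset.range K, ξ (arrival 0 z i) *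
      M.jump v (arrival 0 z i) (M.stock π 0 x z i) (M.choiceAt π 0 x z i) =
      ∑ i ∈ Finset.range K, ξ (arrival 0 z i) * (v (arrival 0 z i) (M.stock π 0 x z (i + 1)) -
        v (arrival 0 z i) (M.stock π 0 x z i)) +
      ∑ i ∈ Finset.range K, ξ (arrival 0 z i) * M.gain (M.choiceAt π 0 x z i) := by
    rw [← Finset.sum_add_distrib]
    exact Finset.sum_congr rfl fun i _ => by rw [jump, stock_succ]; ring
  rw [e5]
  ring

end RevenueModel

/-! ### Resampling one mark, and the compensation formula for one waiting time -/

/-- Replacing one coordinate of a product measure by an independent copy does not change the law. -/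
lemma measurePreserving_update_infinitePi {ι X : Type*} [MeasurableSpace X] [DecidableEq ι]
    (ν : Measure X) [IsProbabilityMeasure ν] (k : ι) :
    MeasurePreserving (fun q : (ι → X) × X => Function.update q.1 k q.2)
      ((Measure.infinitePi fun _ : ι => ν).prod ν) (Measure.infinitePi fun _ : ι => ν) := by
  have hm : Measurable fun q : (ι → X) × X => Function.update q.1 k q.2 := by
    refine measurable_pi_lambda _ fun i => ?_
    rcases eq_or_ne i k with rfl | h
    · simpa using measurable_snd
    · simp only [Function.update_of_ne h]
      exact (measurable_pi_apply i).comp measurable_fst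
  refine ⟨hm, Measure.eq_infinitePi _ fun s t ht => ?_⟩
  rw [Measure.map_apply hm (MeasurableSet.pi s.countable_toSet fun i _ => ht i)]
  have : (fun q : (ι → X) × X => Function.update q.1 k q.2) ⁻¹' (Set.pi s t) =
      (Set.pi (s.erase k : Finset ι) t) ×ˢ (if k ∈ s then t k else univ) := by
    ext ⟨z, y⟩
    simp only [mem_preimage, Set.mem_pi, mem_prod, Finset.mem_coe, Finset.mem_erase]
    constructor
    · intro h
      refine ⟨fun i hi => by simpa [Function.update_of_ne hi.1] using h i hi.2, ?_⟩
      split_ifs with hk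
      · simpa using h k hk
      · trivial
    · rintro ⟨h1, h2⟩ i hi
      rcases eq_or_ne i k with rfl | h
      · simpa [hi] using h2
      · simpa [Function.update_of_ne h] using h1 i ⟨h, hi⟩
  rw [this, Measure.prod_prod, Measure.infinitePi_pi _ fun i _ => ht i]
  split_ifs with hk
  · exact Finset.prod_erase_mul s (fun i => ν (t i)) hk
  · simp [Finset.erase_eq_of_notMem hk]

lemma ae_pos_expMeasure {r : ℝ} : ∀ᵐ e ∂expMeasure r, 0 < e := by
  have h0 : expMeasure r (Iic 0) = 0 := by
    change (volume.withDensity (gammaPDF 1 r)) (Iic 0) = 0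
    rw [withDensity_apply _ measurableSet_Iic, setLIntegral_congr Iio_ae_eq_Iic.symm]
    exact lintegral_exponentialPDF_of_nonpos le_rfl
  rw [ae_iff]
  simp only [not_lt]
  exact h0

lemma integral_expMeasure {r : ℝ} (hr : 0 < r) (f : ℝ → ℝ) :
    ∫ e, f e ∂expMeasure r = ∫ e in Ioi 0, r * Real.exp (-(r * e)) * f e := by
  change ∫ e, f e ∂(volume.withDensity (exponentialPDF r)) = _
  rw [integral_withDensity_eq_integral_toReal_smul
    (by exact (measurable_exponentialPDFReal r).ennreal_ofReal) (by simp [exponentialPDF]),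
    ← integral_Ici_eq_integral_Ioi, ← integral_indicator measurableSet_Ici]
  refine integral_congr_ae (ae_of_all _ fun e => ?_)
  by_cases he : 0 ≤ e
  · have : 0 ≤ r * Real.exp (-(r * e)) := by positivity
    simp [exponentialPDF_of_nonneg he, indicator, he, ENNReal.toReal_ofReal this]
  · simp [exponentialPDF_of_neg (not_le.1 he), indicator, he]

lemma expMeasure_real_Ici {r : ℝ} (hr : 0 < r) {a : ℝ} (ha : 0 ≤ a) :
    (expMeasure r).real (Ici a) = Real.exp (-(r * a)) := by
  have := isProbabilityMeasure_expMeasure hr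
  have hac : expMeasure r {a} = 0 := by
    change (volume.withDensity (exponentialPDF r)) {a} = 0
    exact withDensity_absolutelyContinuous _ _ (by simp)
  have h1 : (expMeasure r).real (Iic a) = 1 - Real.exp (-(r * a)) := by
    rw [← cdf_eq_real, cdf_expMeasure_eq hr, if_pos ha]
  have h2 : (expMeasure r).real (Ici a) = (expMeasure r).real (Ioi a) := by
    have : Ici a = Ioi a ∪ {a} := by rw [union_comm, singleton_union, Ioi_insert]
    refine le_antisymm ?_ (measureReal_mono Ioi_subset_Ici_self)
    rw [this]
    refine (measureReal_union_le _ _).trans ?_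
    simp [Measure.real, hac]
  rw [h2, ← compl_Iic, probReal_compl_eq_one_sub measurableSet_Iic, h1]
  ring

/-- The compensation formula for one exponential waiting time which starts at `σ`: the hazard rate is
constant. -/
lemma integral_expMeasure_add {r : ℝ} (hr : 0 < r) {s σ T : ℝ} (hσ : s ≤ σ) {H : ℝ → ℝ}
    (hH : Measurable H) {C : ℝ} (hC : ∀ t, |H t| ≤ C) (hT : ∀ t, T < t → H t = 0) :
    ∫ e, H (σ + e) ∂expMeasure r =
      ∫ e, r * (∫ t in Ioc s T, if σ < t ∧ t ≤ σ + e then H t else 0) ∂expMeasure r := by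
  have := isProbabilityMeasure_expMeasure hr
  have hmeas : Measurable fun q : ℝ × ℝ => if σ < q.2 ∧ q.2 ≤ σ + q.1 then H q.2 else 0 :=
    Measurable.ite ((measurableSet_lt measurable_const measurable_snd).inter
      (measurableSet_le measurable_snd (measurable_const.add measurable_fst)))
      (hH.comp measurable_snd) measurable_const
  have hint : Integrable (fun q : ℝ × ℝ => if σ < q.2 ∧ q.2 ≤ σ + q.1 then H q.2 else 0)
      ((expMeasure r).prod (volume.restrict (Ioc s T))) := by
    refine Integrable.of_bound hmeas.aestronglyMeasurable C (ae_of_all _ fun q => ?_)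
    split_ifs
    · exact hC _
    · simpa using (abs_nonneg _).trans (hC 0)
  rw [integral_const_mul, integral_integral_swap hint]
  have inner : ∀ t, ∫ e, (if σ < t ∧ t ≤ σ + e then H t else 0) ∂expMeasure r =
      (Ioi σ).indicator (fun t => Real.exp (-(r * (t - σ))) * H t) t := by
    intro t
    by_cases h : σ < t
    · have : (fun e => if σ < t ∧ t ≤ σ + e then H t else 0) =
          (Ici (t - σ)).indicator fun _ => H t := by
        funext e
        have : t ≤ σ + e ↔ e ∈ Ici (t - σ) := by
          rw [mem_Ici]
          constructor <;> intro h <;> linarith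
        simp only [h, true_and, this, indicator]
      rw [this, integral_indicator_const _ measurableSet_Ici, expMeasure_real_Ici hr (by linarith),
        indicator_of_mem (show t ∈ Ioi σ from h), smul_eq_mul]
    · simp [h]
  simp_rw [inner]
  rw [setIntegral_indicator measurableSet_Ioi, Ioc_inter_Ioi, max_eq_right hσ,
    integral_expMeasure hr]
  have hIoi : ∫ t in Ioc σ T, Real.exp (-(r * (t - σ))) * H t =
      ∫ t in Ioi σ, Real.exp (-(r * (t - σ))) * H t := by
    rw [← integral_indicator measurableSet_Ioc, ← integral_indicator measurableSet_Ioi]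
    refine integral_congr_ae (ae_of_all _ fun t => ?_)
    by_cases h1 : σ < t <;> by_cases h2 : t ≤ T
    · simp [indicator, h1, h2]
    · simp [indicator, h1, h2, hT t (not_le.1 h2)]
    · simp [indicator, h1]
    · simp [indicator, h1]
  rw [hIoi, ← integral_indicator measurableSet_Ioi, ← integral_indicator measurableSet_Ioi,
    ← integral_const_mul,
    ← integral_add_left_eq_self (fun t => r * (Ioi σ).indicator _ t) σ]
  refine integral_congr_ae (ae_of_all _ fun e => ?_)
  by_cases he : 0 < e
  · simp [indicator, he]
    ring
  · simp [indicator, he]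

/-! ### The compensation formula -/

namespace RevenueModel

variable {m n : ℕ} (M : RevenueModel m n)

/-- The law of the two randomization variables of a customer. -/
def uniformSquare : Measure (ℝ × ℝ) :=
  (volume.restrict (Icc (0 : ℝ) 1)).prod (volume.restrict (Icc (0 : ℝ) 1))

/-- The law of the marks of one customer. -/
def markLaw : Measure (ℝ × ℝ × ℝ) := (expMeasure M.rate).prod uniformSquare

/-- The law of the sequence of marks. -/
def noiseLaw : Measure (ℕ → ℝ × ℝ × ℝ) := Measure.infinitePi fun _ => M.markLaw

instance : IsProbabilityMeasure (volume.restrict (Icc (0 : ℝ) 1)) := ⟨by simp⟩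

instance : IsProbabilityMeasure uniformSquare :=
  inferInstanceAs (IsProbabilityMeasure (Measure.prod _ _))

instance : IsProbabilityMeasure M.markLaw :=
  have := isProbabilityMeasure_expMeasure M.rate_pos
  inferInstanceAs (IsProbabilityMeasure (Measure.prod _ _))

instance : IsProbabilityMeasure M.noiseLaw :=
  inferInstanceAs (IsProbabilityMeasure (Measure.infinitePi _))

/-- A bounded measurable test process on the space of marks whose value at a time `t` up to the
`k`-th arrival is determined by the marks of the customers before. -/
structure IsNonanticipating (s : ℝ) (ξ : ℝ → (ℕ → ℝ × ℝ × ℝ) → ℝ) : Prop where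
  measurable : Measurable fun p : ℝ × (ℕ → ℝ × ℝ × ℝ) => ξ p.1 p.2
  bounded : ∃ C, ∀ t z, |ξ t z| ≤ C
  congr : ∀ k z z', (∀ i, 0 < (z i).1) → (∀ i, 0 < (z' i).1) → (∀ i < k, z i = z' i) →
    ∀ t, epoch s z k < t → t ≤ arrival s z k → t ≤ arrival s z' k → ξ t z = ξ t z'

/-- The contribution of the `k`-th customer to `∑ ξ_t φ(t, X_{t-}, choice)`, the sum over the
customers who arrive up to time `T`. -/
def arrivalTerm (π : M.Policy) (s : ℝ) (x : M.State) (ξ : ℝ → (ℕ → ℝ × ℝ × ℝ) → ℝ)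
    (φ : ℝ → M.State → Option (Fin n) → ℝ) (k : ℕ) (z : ℕ → ℝ × ℝ × ℝ) : ℝ :=
  if arrival s z k ≤ M.T then
    ξ (arrival s z k) z * φ (arrival s z k) (M.stock π s x z k) (M.choiceAt π s x z k) else 0

/-- The compensator of `arrivalTerm`: the integral of its conditional intensity over the time during
which the `k`-th customer is awaited. -/
def compensator (π : M.Policy) (s : ℝ) (x : M.State) (ξ : ℝ → (ℕ → ℝ × ℝ × ℝ) → ℝ)
    (φ : ℝ → M.State → Option (Fin n) → ℝ) (k : ℕ) (z : ℕ → ℝ × ℝ × ℝ) : ℝ :=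
  M.rate * ∫ t in Ioc s M.T, if epoch s z k < t ∧ t ≤ arrival s z k then
    ξ t z * M.meanChoice π t (M.stock π s x z k) (φ t (M.stock π s x z k)) else 0

variable {M} {π : M.Policy} {s : ℝ} {x : M.State}

lemma abs_meanChoice_le (hπ : M.IsAdmissible π) {t : ℝ} {y : M.State} {φ : Option (Fin n) → ℝ}
    {C : ℝ} (hC : ∀ o, |φ o| ≤ C) : |M.meanChoice π t y φ| ≤ C := by
  rw [← meanChoice_const (M := M) hπ t y C]
  unfold meanChoice
  refine (Finset.abs_sum_le_sum_abs _ _).trans (Finset.sum_le_sum fun S _ => ?_)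
  rw [abs_mul, abs_of_nonneg (hπ.nonneg _ _ _)]
  refine mul_le_mul_of_nonneg_left ?_ (hπ.nonneg _ _ _)
  refine (Finset.abs_sum_le_sum_abs _ _).trans (Finset.sum_le_sum fun o _ => ?_)
  rw [abs_mul, abs_of_nonneg (M.P_nonneg _ _)]
  exact mul_le_mul_of_nonneg_left (hC o) (M.P_nonneg _ _)

lemma measurable_meanChoice (hπ : M.IsAdmissible π) {φ : ℝ → M.State → Option (Fin n) → ℝ}
    (hφ : ∀ y o, Measurable fun t => φ t y o) (y : M.State) :
    Measurable fun t => M.meanChoice π t y (φ t y) := by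
  unfold meanChoice
  exact Finset.measurable_sum _ fun S _ =>
    (((hπ.continuous y S).comp continuous_clock).measurable).mul
      (Finset.measurable_sum _ fun o _ => (hφ y o).const_mul _)

lemma measurable_choice_uv (hπ : M.IsAdmissible π) (t : ℝ) (y : M.State)
    (φ : Option (Fin n) → ℝ) : Measurable fun q : ℝ × ℝ => φ (M.choice π t y q.1 q.2) :=
  measurable_comp_choice hπ (κ := Unit) (N := fun _ => ()) measurable_const measurable_fst
    measurable_snd measurable_const (fun _ => y) (f := fun _ _ o => φ o)
    fun _ _ => measurable_const

lemma integral_choice (hπ : M.IsAdmissible π) (t : ℝ) (y : M.State) (φ : Option (Fin n) → ℝ) :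
    ∫ q, φ (M.choice π t y q.1 q.2) ∂uniformSquare = M.meanChoice π t y φ := by
  have hm := measurable_choice_uv hπ t y φ
  have hi : Integrable (fun q : ℝ × ℝ => φ (M.choice π t y q.1 q.2)) uniformSquare :=
    Integrable.of_bound hm.aestronglyMeasurable (∑ o, |φ o|) (ae_of_all _ fun q =>
      Finset.single_le_sum (f := fun o => |φ o|) (fun _ _ => abs_nonneg _) (Finset.mem_univ _))
  rw [uniformSquare] at hi ⊢
  rw [integral_prod _ hi]
  simp only [choice]
  simp_rw [integral_sampleFrom (M.P_nonneg _) (M.P_sum _)]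
  exact integral_sampleFrom (fun S => hπ.nonneg _ _ S) (hπ.sum_eq_one _ _)
    fun S => ∑ o, M.P S o * φ o

lemma measurable_epoch (s : ℝ) (k : ℕ) : Measurable fun z => epoch s z k := by
  unfold epoch
  fun_prop

lemma measurable_stock (hπ : M.IsAdmissible π) (s : ℝ) (x : M.State) (k : ℕ) :
    Measurable fun z => M.stock π s x z k := by
  have h : Measurable (M.deplete x) := measurable_of_countable _
  exact h.comp (measurable_salesTo hπ s x k)

lemma measurable_arrivalTerm (hπ : M.IsAdmissible π) {ξ : ℝ → (ℕ → ℝ × ℝ × ℝ) → ℝ}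
    (hξ : IsNonanticipating s ξ) {φ : ℝ → M.State → Option (Fin n) → ℝ}
    (hφ : ∀ y o, Measurable fun t => φ t y o) (k : ℕ) :
    Measurable (M.arrivalTerm π s x ξ φ k) := by
  have ha := measurable_arrival s k
  refine Measurable.ite (measurableSet_le ha measurable_const) (Measurable.mul ?_ ?_)
    measurable_const
  · exact hξ.measurable.comp (ha.prodMk measurable_id)
  · have hu : Measurable fun z : ℕ → ℝ × ℝ × ℝ => (z k).2.1 := by fun_prop
    have hw : Measurable fun z : ℕ → ℝ × ℝ × ℝ => (z k).2.2 := by fun_prop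
    have hf : ∀ (y : M.State) (o : Option (Fin n)), Measurable fun z : ℕ → ℝ × ℝ × ℝ =>
      φ (arrival s z k) y o := fun y o => (hφ y o).comp ha
    exact measurable_comp_choice hπ ha hu hw (measurable_stock hπ s x k) (fun y => y) hf

lemma measurable_compensator_integrand (hπ : M.IsAdmissible π) {ξ : ℝ → (ℕ → ℝ × ℝ × ℝ) → ℝ}
    (hξ : IsNonanticipating s ξ) {φ : ℝ → M.State → Option (Fin n) → ℝ}
    (hφ : ∀ y o, Measurable fun t => φ t y o) (k : ℕ) :
    Measurable fun q : (ℕ → ℝ × ℝ × ℝ) × ℝ => if epoch s q.1 k < q.2 ∧ q.2 ≤ arrival s q.1 k then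
      ξ q.2 q.1 * M.meanChoice π q.2 (M.stock π s x q.1 k) (φ q.2 (M.stock π s x q.1 k)) else 0 := by
  refine Measurable.ite ((measurableSet_lt ((measurable_epoch s k).comp measurable_fst)
    measurable_snd).inter (measurableSet_le measurable_snd ((measurable_arrival s k).comp
      measurable_fst))) (Measurable.mul ?_ ?_) measurable_const
  · exact hξ.measurable.comp measurable_swap
  · exact measurable_apply_state (M := M) (g := fun t y => M.meanChoice π t y (φ t y))
      (measurable_meanChoice hπ hφ) measurable_snd ((measurable_stock hπ s x k).comp measurable_fst)

lemma measurable_compensator (hπ : M.IsAdmissible π) {ξ : ℝ → (ℕ → ℝ × ℝ × ℝ) → ℝ}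
    (hξ : IsNonanticipating s ξ) {φ : ℝ → M.State → Option (Fin n) → ℝ}
    (hφ : ∀ y o, Measurable fun t => φ t y o) (k : ℕ) :
    Measurable (M.compensator π s x ξ φ k) :=
  ((measurable_compensator_integrand hπ hξ hφ k).stronglyMeasurable.integral_prod_right'.measurable
    ).const_mul _

lemma ae_pos_noiseLaw : ∀ᵐ z ∂M.noiseLaw, ∀ k, 0 < (z k).1 := by
  rw [ae_all_iff]
  intro k
  have h1 : ∀ᵐ y ∂M.markLaw, 0 < y.1 :=
    Measure.quasiMeasurePreserving_fst.ae ae_pos_expMeasure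
  exact (measurePreserving_eval_infinitePi (fun _ : ℕ => M.markLaw) k).quasiMeasurePreserving.ae h1

lemma abs_arrivalTerm_le (hs : 0 ≤ s) {ξ : ℝ → (ℕ → ℝ × ℝ × ℝ) → ℝ} {C₁ C₂ : ℝ}
    (hC₁ : ∀ t z, |ξ t z| ≤ C₁) {φ : ℝ → M.State → Option (Fin n) → ℝ}
    (hC₂ : ∀ t ∈ Icc 0 M.T, ∀ y o, |φ t y o| ≤ C₂) (k : ℕ) {z : ℕ → ℝ × ℝ × ℝ}
    (hz : ∀ k, 0 < (z k).1) : |M.arrivalTerm π s x ξ φ k z| ≤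
      C₁ * C₂ * M.arrivalTerm π s x (fun _ _ => 1) (fun _ _ _ => 1) k z := by
  unfold arrivalTerm
  split_ifs with h
  · rw [abs_mul, mul_one, mul_one]
    exact mul_le_mul (hC₁ _ _) (hC₂ _ ⟨hs.trans (lt_arrival hz k).le, h⟩ _ _) (abs_nonneg _)
      ((abs_nonneg _).trans (hC₁ 0 z))
  · simp

lemma arrivalTerm_one_mem (k : ℕ) (z : ℕ → ℝ × ℝ × ℝ) :
    M.arrivalTerm π s x (fun _ _ => 1) (fun _ _ _ => 1) k z ∈ Icc (0 : ℝ) 1 := by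
  unfold arrivalTerm
  split_ifs <;> simp

lemma integrable_ite_awaiting {a b c d : ℝ} :
    IntegrableOn (fun t : ℝ => if a < t ∧ t ≤ b then (1 : ℝ) else 0) (Ioc c d) := by
  have : (fun t : ℝ => if a < t ∧ t ≤ b then (1 : ℝ) else 0) = (Ioc a b).indicator fun _ => 1 := by
    funext t
    simp [indicator]
  rw [this]
  exact (integrable_const _).indicator measurableSet_Ioc

lemma abs_compensator_le (hπ : M.IsAdmissible π) (hs : 0 ≤ s)
    {ξ : ℝ → (ℕ → ℝ × ℝ × ℝ) → ℝ} {C₁ C₂ : ℝ}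
    (hC₁ : ∀ t z, |ξ t z| ≤ C₁) {φ : ℝ → M.State → Option (Fin n) → ℝ}
    (hC₂ : ∀ t ∈ Icc 0 M.T, ∀ y o, |φ t y o| ≤ C₂) (k : ℕ) (z : ℕ → ℝ × ℝ × ℝ) :
    |M.compensator π s x ξ φ k z| ≤
      C₁ * C₂ * M.compensator π s x (fun _ _ => 1) (fun _ _ _ => 1) k z := by
  unfold compensator
  rw [abs_mul, abs_of_pos M.rate_pos, mul_left_comm, ← integral_const_mul]
  refine mul_le_mul_of_nonneg_left ?_ M.rate_pos.le
  refine abs_integral_le_integral_abs.trans ?_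
  simp only [meanChoice_const hπ, mul_one]
  refine integral_mono_of_nonneg (ae_of_all _ fun _ => abs_nonneg _)
    (integrable_ite_awaiting.const_mul _) ?_
  filter_upwards [ae_restrict_mem measurableSet_Ioc] with t ht
  split_ifs with h
  · rw [abs_mul, mul_one]
    exact mul_le_mul (hC₁ _ _) (abs_meanChoice_le hπ fun o =>
      hC₂ _ ⟨hs.trans ht.1.le, ht.2⟩ _ _) (abs_nonneg _) ((abs_nonneg _).trans (hC₁ 0 z))
  · simp

lemma compensator_one_mem (hπ : M.IsAdmissible π) (hsT : s ≤ M.T) (k : ℕ)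
    (z : ℕ → ℝ × ℝ × ℝ) :
    M.compensator π s x (fun _ _ => 1) (fun _ _ _ => 1) k z ∈ Icc 0 (M.rate * (M.T - s)) := by
  unfold compensator
  simp only [meanChoice_const hπ, mul_one]
  constructor
  · refine mul_nonneg M.rate_pos.le (integral_nonneg fun t => ?_)
    dsimp only
    split_ifs <;> simp
  · refine mul_le_mul_of_nonneg_left ?_ M.rate_pos.le
    calc _ ≤ ∫ t in Ioc s M.T, (1 : ℝ) := by
          refine integral_mono integrable_ite_awaiting (integrable_const _) fun t => ?_
          dsimp only
          split_ifs <;> simp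
      _ = M.T - s := by simp [hsT]

lemma isNonanticipating_one (s : ℝ) : IsNonanticipating s fun _ _ => 1 :=
  ⟨measurable_const, ⟨1, fun _ _ => by simp⟩, fun _ _ _ _ _ _ _ _ _ _ => rfl⟩

/-- What happens up to the `k`-th arrival does not depend on the later marks. -/
lemma salesTo_congr {z z' : ℕ → ℝ × ℝ × ℝ} (k : ℕ) (h : ∀ i < k, z i = z' i) :
    M.salesTo π s x z k = M.salesTo π s x z' k := by
  induction k with
  | zero => rfl
  | succ k ih =>
    have h1 := ih fun i hi => h i (hi.trans k.lt_succ_self)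
    have h2 : arrival s z k = arrival s z' k := by
      unfold arrival
      congr 1
      exact Finset.sum_congr rfl fun i hi => by rw [h i (Finset.mem_range.1 hi)]
    funext j
    simp only [salesTo, h1, h2, h k k.lt_succ_self]

lemma stock_congr {z z' : ℕ → ℝ × ℝ × ℝ} (k : ℕ) (h : ∀ i < k, z i = z' i) :
    M.stock π s x z k = M.stock π s x z' k := by
  rw [stock, stock, salesTo_congr k h]

lemma epoch_congr {z z' : ℕ → ℝ × ℝ × ℝ} (k : ℕ) (h : ∀ i < k, z i = z' i) :
    epoch s z k = epoch s z' k := by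
  unfold epoch
  congr 1
  exact Finset.sum_congr rfl fun i hi => by rw [h i (Finset.mem_range.1 hi)]

section

variable {ξ : ℝ → (ℕ → ℝ × ℝ × ℝ) → ℝ} {φ : ℝ → M.State → Option (Fin n) → ℝ} {C : ℝ}

lemma integrable_arrivalTerm (hπ : M.IsAdmissible π) (hs : 0 ≤ s) (hξ : IsNonanticipating s ξ)
    (hφ : ∀ y o, Measurable fun t => φ t y o) (hC : ∀ t ∈ Icc 0 M.T, ∀ y o, |φ t y o| ≤ C) (k : ℕ) :
    Integrable (M.arrivalTerm π s x ξ φ k) M.noiseLaw := by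
  obtain ⟨C₁, hC₁⟩ := hξ.bounded
  refine Integrable.of_bound (measurable_arrivalTerm hπ hξ hφ k).aestronglyMeasurable |C₁ * C| ?_
  filter_upwards [ae_pos_noiseLaw] with z hz
  refine (abs_arrivalTerm_le hs hC₁ hC k hz).trans ?_
  have := arrivalTerm_one_mem (M := M) (π := π) (s := s) (x := x) k z
  calc _ ≤ |C₁ * C| * M.arrivalTerm π s x (fun _ _ => 1) (fun _ _ _ => 1) k z :=
        mul_le_mul_of_nonneg_right (le_abs_self _) this.1
    _ ≤ |C₁ * C| * 1 := mul_le_mul_of_nonneg_left this.2 (abs_nonneg _)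
    _ = _ := mul_one _

lemma integrable_compensator (hπ : M.IsAdmissible π) (hs : 0 ≤ s) (hsT : s ≤ M.T)
    (hξ : IsNonanticipating s ξ)
    (hφ : ∀ y o, Measurable fun t => φ t y o) (hC : ∀ t ∈ Icc 0 M.T, ∀ y o, |φ t y o| ≤ C) (k : ℕ) :
    Integrable (M.compensator π s x ξ φ k) M.noiseLaw := by
  obtain ⟨C₁, hC₁⟩ := hξ.bounded
  refine Integrable.of_bound (measurable_compensator hπ hξ hφ k).aestronglyMeasurable
    (|C₁ * C| * (M.rate * (M.T - s))) (ae_of_all _ fun z => ?_)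
  refine (abs_compensator_le hπ hs hC₁ hC k z).trans ?_
  have := compensator_one_mem (x := x) hπ hsT k z
  exact (mul_le_mul_of_nonneg_right (le_abs_self _) this.1).trans
    (mul_le_mul_of_nonneg_left this.2 (abs_nonneg _))

/-- The compensation formula for the `k`-th customer: given the marks of the customers before, both
sides only depend on the `k`-th mark, which is independent of them. -/
theorem integral_arrivalTerm (hπ : M.IsAdmissible π) (hs : 0 ≤ s) (hsT : s ≤ M.T)
    (hξ : IsNonanticipating s ξ)
    (hφ : ∀ y o, Measurable fun t => φ t y o) (hC : ∀ t ∈ Icc 0 M.T, ∀ y o, |φ t y o| ≤ C) (k : ℕ) :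
    ∫ z, M.arrivalTerm π s x ξ φ k z ∂M.noiseLaw = ∫ z, M.compensator π s x ξ φ k z ∂M.noiseLaw := by
  have := isProbabilityMeasure_expMeasure M.rate_pos
  obtain ⟨C₁, hC₁⟩ := hξ.bounded
  -- resample the marks of the `k`-th customer
  have hpres := measurePreserving_update_infinitePi (ι := ℕ) M.markLaw k
  have resample : ∀ f : (ℕ → ℝ × ℝ × ℝ) → ℝ, Integrable f M.noiseLaw →
      ∫ z, f z ∂M.noiseLaw = ∫ z, ∫ y, f (Function.update z k y) ∂M.markLaw ∂M.noiseLaw := by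
    intro f hf
    have h := hpres.integrable_comp_of_integrable hf
    calc ∫ z, f z ∂M.noiseLaw = ∫ q, f (Function.update q.1 k q.2) ∂(M.noiseLaw.prod M.markLaw) := by
          rw [noiseLaw]
          conv_lhs => rw [← hpres.map_eq]
          refine integral_map hpres.aemeasurable ?_
          rw [hpres.map_eq]
          exact hf.aestronglyMeasurable
      _ = _ := integral_prod _ h
  rw [resample _ (integrable_arrivalTerm hπ hs hξ hφ hC k),
    resample _ (integrable_compensator hπ hs hsT hξ hφ hC k)]
  refine integral_congr_ae ?_
  filter_upwards [ae_pos_noiseLaw] with z hz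
  have hsσ : s ≤ epoch s z k := le_epoch hz k
  obtain ⟨σ, hσ⟩ : ∃ σ, σ = epoch s z k := ⟨_, rfl⟩
  obtain ⟨Y, hY⟩ : ∃ Y, Y = M.stock π s x z k := ⟨_, rfl⟩
  -- the path `z₀` on which the `k`-th customer only arrives after `T` carries the values of the test
  -- process up to the arrival of this customer
  obtain ⟨z₀, hz₀⟩ : ∃ z₀, z₀ = Function.update z k (M.T - s + 1, 0, 0) := ⟨_, rfl⟩
  have hagree : ∀ y, ∀ i < k, z i = Function.update z k y i := fun y i hi =>
    (Function.update_of_ne hi.ne _ _).symm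
  have hpos : ∀ y : ℝ × ℝ × ℝ, 0 < y.1 → ∀ i, 0 < (Function.update z k y i).1 := by
    intro y hy i
    rcases eq_or_ne i k with rfl | h
    · simpa using hy
    · simpa [Function.update_of_ne h] using hz i
  have hep : ∀ y, epoch s (Function.update z k y) k = σ := fun y => by
    rw [← epoch_congr k (hagree y), hσ]
  have hst : ∀ y, M.stock π s x (Function.update z k y) k = Y := fun y => by
    rw [← stock_congr k (hagree y), hY]
  have har : ∀ y : ℝ × ℝ × ℝ, arrival s (Function.update z k y) k = σ + y.1 := fun y => by
    rw [arrival_eq_add, hep, Function.update_self]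
  have hξz : ∀ y : ℝ × ℝ × ℝ, 0 < y.1 → ∀ t, σ < t → t ≤ σ + y.1 → t ≤ M.T →
      ξ t (Function.update z k y) = ξ t z₀ := by
    intro y hy t h1 h2 h3
    refine hξ.congr k _ _ (hpos y hy) ?_ (fun i hi => ?_) t (by rwa [hep]) (by rwa [har]) ?_
    · rw [hz₀]
      exact hpos _ (by simp only []; linarith)
    · rw [hz₀, ← hagree _ i hi, ← hagree _ i hi]
    · rw [hz₀, har]
      simp only []
      rw [hσ]
      linarith
  obtain ⟨H, hH⟩ : ∃ H : ℝ → ℝ, ∀ t, H t = if t ∈ Icc s M.T then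
    ξ t z₀ * M.meanChoice π t Y (φ t Y) else 0 := ⟨_, fun _ => rfl⟩
  have hHm : Measurable H := by
    rw [funext hH]
    exact Measurable.ite measurableSet_Icc ((hξ.measurable.comp measurable_prodMk_right).mul
      (measurable_meanChoice hπ hφ Y)) measurable_const
  have hHC : ∀ t, |H t| ≤ |C₁ * C| := by
    intro t
    rw [hH]
    split_ifs with h
    · rw [abs_mul]
      refine le_trans (mul_le_mul (hC₁ _ _) (abs_meanChoice_le hπ fun o =>
        hC _ ⟨hs.trans h.1, h.2⟩ _ _) (abs_nonneg _) ((abs_nonneg _).trans (hC₁ 0 z)))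
        (le_abs_self _)
    · simpa using abs_nonneg (C₁ * C)
  have hexp := integral_expMeasure_add M.rate_pos (σ := σ) (T := M.T) (hσ ▸ hsσ) hHm hHC
    fun t ht => by rw [hH, if_neg fun h => absurd h.2 (not_le.2 ht)]
  have hmupd : Measurable fun y : ℝ × ℝ × ℝ => Function.update z k y := measurable_update z
  -- both sides as integrals over the waiting time
  have hleft : ∫ y, M.arrivalTerm π s x ξ φ k (Function.update z k y) ∂M.markLaw =
      ∫ e, H (σ + e) ∂expMeasure M.rate := by
    have hi : Integrable (fun y => M.arrivalTerm π s x ξ φ k (Function.update z k y))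
        ((expMeasure M.rate).prod uniformSquare) := by
      refine Integrable.of_bound ((measurable_arrivalTerm hπ hξ hφ k).comp
        hmupd).aestronglyMeasurable |C₁ * C| ?_
      filter_upwards [Measure.quasiMeasurePreserving_fst.ae ae_pos_expMeasure] with y hy
      refine (abs_arrivalTerm_le hs hC₁ hC k (hpos y hy)).trans ?_
      have := arrivalTerm_one_mem (M := M) (π := π) (s := s) (x := x) k (Function.update z k y)
      exact (mul_le_mul_of_nonneg_right (le_abs_self _) this.1).trans
        (mul_le_of_le_one_right (abs_nonneg _) this.2)
    rw [markLaw, integral_prod _ hi]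
    refine integral_congr_ae ?_
    filter_upwards [ae_pos_expMeasure] with e he
    have hse : s ≤ σ + e := by rw [hσ]; linarith
    by_cases hT : σ + e ≤ M.T
    · have : ∀ q : ℝ × ℝ, M.arrivalTerm π s x ξ φ k (Function.update z k (e, q)) =
          ξ (σ + e) z₀ * φ (σ + e) Y (M.choice π (σ + e) Y q.1 q.2) := by
        intro q
        rw [arrivalTerm, har, if_pos hT, hξz (e, q) he _ (by simpa using he) le_rfl hT, hst,
          choiceAt, har, hst, Function.update_self]
      simp_rw [this]
      rw [integral_const_mul, integral_choice hπ, hH, if_pos ⟨hse, hT⟩]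
    · have : ∀ q : ℝ × ℝ, M.arrivalTerm π s x ξ φ k (Function.update z k (e, q)) = 0 := by
        intro q
        rw [arrivalTerm, har, if_neg hT]
      simp_rw [this]
      rw [hH, if_neg fun h => hT h.2, integral_zero]
  have hright : ∫ y, M.compensator π s x ξ φ k (Function.update z k y) ∂M.markLaw =
      ∫ e, M.rate * (∫ t in Ioc s M.T, if σ < t ∧ t ≤ σ + e then H t else 0)
        ∂expMeasure M.rate := by
    have hi : Integrable (fun y => M.compensator π s x ξ φ k (Function.update z k y))
        ((expMeasure M.rate).prod uniformSquare) := by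
      refine Integrable.of_bound ((measurable_compensator hπ hξ hφ k).comp
        hmupd).aestronglyMeasurable (|C₁ * C| * (M.rate * (M.T - s))) (ae_of_all _ fun y => ?_)
      refine (abs_compensator_le hπ hs hC₁ hC k _).trans ?_
      have := compensator_one_mem (x := x) hπ hsT k (Function.update z k y)
      exact (mul_le_mul_of_nonneg_right (le_abs_self _) this.1).trans
        (mul_le_mul_of_nonneg_left this.2 (abs_nonneg _))
    rw [markLaw, integral_prod _ hi]
    refine integral_congr_ae ?_
    filter_upwards [ae_pos_expMeasure] with e he
    have : ∀ q : ℝ × ℝ, M.compensator π s x ξ φ k (Function.update z k (e, q)) =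
        M.rate * (∫ t in Ioc s M.T, if σ < t ∧ t ≤ σ + e then H t else 0) := by
      intro q
      rw [compensator, hep, har, hst]
      congr 1
      refine setIntegral_congr_fun measurableSet_Ioc fun t ht => ?_
      simp only []
      split_ifs with h
      · rw [hξz (e, q) he t h.1 h.2 ht.2, hH, if_pos ⟨ht.1.le, ht.2⟩]
      · rfl
    simp_rw [this]
    simp
  simp only [hleft, hright, hexp]

end

end RevenueModel

/-! ### Dynkin's formula -/

lemma integrable_tsum_of_summable_integral_norm {α : Type*} [MeasurableSpace α] {μ : Measure α}
    {F : ℕ → α → ℝ} (hF : ∀ k, Integrable (F k) μ) (hs : Summable fun k => ∫ a, ‖F k a‖ ∂μ) :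
    Integrable (fun a => ∑' k, F k a) μ := by
  have hfin : ∫⁻ a, ∑' k, ‖F k a‖ₑ ∂μ < ⊤ := by
    rw [lintegral_tsum fun k => (hF k).1.enorm]
    have : ∀ k, ∫⁻ a, ‖F k a‖ₑ ∂μ = ENNReal.ofReal (∫ a, ‖F k a‖ ∂μ) := fun k =>
      (ofReal_integral_norm_eq_lintegral_enorm (hF k)).symm
    simp_rw [this]
    exact hs.tsum_ofReal_lt_top
  have hae : ∀ᵐ a ∂μ, Summable fun k => F k a := by
    have := ae_lt_top' (AEMeasurable.tsum fun k => (hF k).1.enorm) hfin.ne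
    filter_upwards [this] with a ha
    exact Summable.of_nnnorm (ENNReal.tsum_coe_ne_top_iff_summable.1 ha.ne)
  refine ⟨aestronglyMeasurable_of_tendsto_ae Filter.atTop
    (f := fun N a => ∑ k ∈ Finset.range N, F k a) (fun N => ?_) ?_, ?_⟩
  · exact Finset.aestronglyMeasurable_fun_sum _ fun k _ => (hF k).1
  · filter_upwards [hae] with a ha using ha.hasSum.tendsto_sum_nat
  · exact (lintegral_mono fun a => enorm_tsum_le_tsum_enorm).trans_lt hfin

namespace RevenueModel

variable {m n : ℕ} {M : RevenueModel m n} {π : M.Policy} {s : ℝ} {x : M.State}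

lemma sum_compensator_one_le (hπ : M.IsAdmissible π) (hsT : s ≤ M.T) {z : ℕ → ℝ × ℝ × ℝ}
    (hz : ∀ k, 0 < (z k).1) (N : ℕ) :
    ∑ k ∈ Finset.range N, M.compensator π s x (fun _ _ => 1) (fun _ _ _ => 1) k z ≤
      M.rate * (M.T - s) := by
  unfold compensator
  simp only [meanChoice_const hπ, mul_one]
  rw [← Finset.mul_sum, ← integral_finsetSum _ fun k _ => integrable_ite_awaiting]
  refine mul_le_mul_of_nonneg_left ?_ M.rate_pos.le
  calc _ ≤ ∫ t in Ioc s M.T, (1 : ℝ) := by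
        refine integral_mono (integrable_finsetSum _ fun k _ => integrable_ite_awaiting)
          (integrable_const _) fun t => ?_
        dsimp only
        rw [← Finset.sum_filter, Finset.sum_const, nsmul_eq_mul, mul_one]
        have : (Finset.filter (fun k => epoch s z k < t ∧ t ≤ arrival s z k)
            (Finset.range N)).card ≤ 1 := by
          refine Finset.card_le_one.2 fun a ha b hb => ?_
          simp only [Finset.mem_filter] at ha hb
          rw [← ncard_arrival_lt hz ha.2.1 ha.2.2, ← ncard_arrival_lt hz hb.2.1 hb.2.2]
        exact_mod_cast this
    _ = M.T - s := by simp [hsT]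

/-- The expected number of arrivals up to time `T` is finite. -/
lemma summable_integral_arrivalTerm_one (hπ : M.IsAdmissible π) (hs : 0 ≤ s) (hsT : s ≤ M.T) :
    Summable fun k => ∫ z, M.arrivalTerm π s x (fun _ _ => 1) (fun _ _ _ => 1) k z ∂M.noiseLaw := by
  refine summable_of_sum_range_le (c := M.rate * (M.T - s))
    (fun k => integral_nonneg fun z => (arrivalTerm_one_mem k z).1) fun N => ?_
  have h1 : ∀ t ∈ Icc 0 M.T, ∀ (y : M.State) (o : Option (Fin n)), |(1 : ℝ)| ≤ 1 := by simp
  have hm : ∀ (y : M.State) (o : Option (Fin n)), Measurable fun _ : ℝ => (1 : ℝ) :=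
    fun _ _ => measurable_const
  have he : ∀ k, ∫ z, M.arrivalTerm π s x (fun _ _ => 1) (fun _ _ _ => 1) k z ∂M.noiseLaw =
      ∫ z, M.compensator π s x (fun _ _ => 1) (fun _ _ _ => 1) k z ∂M.noiseLaw := fun k =>
    integral_arrivalTerm hπ hs hsT (isNonanticipating_one s) hm h1 k
  have hi : ∀ k, Integrable (M.compensator π s x (fun _ _ => 1) (fun _ _ _ => 1) k) M.noiseLaw :=
    fun k => integrable_compensator hπ hs hsT (isNonanticipating_one s) hm h1 k
  simp_rw [he]
  rw [← integral_finsetSum _ fun k _ => hi k]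
  calc _ ≤ ∫ z, M.rate * (M.T - s) ∂M.noiseLaw := by
        refine integral_mono_ae (integrable_finsetSum _ fun k _ => hi k) (integrable_const _) ?_
        filter_upwards [ae_pos_noiseLaw] with z hz using sum_compensator_one_le hπ hsT hz N
    _ = _ := by simp

lemma ae_isRegular (hπ : M.IsAdmissible π) (hs : 0 ≤ s) (hsT : s ≤ M.T) :
    ∀ᵐ z ∂M.noiseLaw, IsRegular M.T s z := by
  have hsum := summable_integral_arrivalTerm_one (x := M.full) hπ hs hsT
  have hmeas : ∀ k, MeasurableSet {z | arrival s z k ≤ M.T} := fun k =>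
    measurableSet_le (measurable_arrival s k) measurable_const
  have he : ∀ k, M.noiseLaw {z | arrival s z k ≤ M.T} = ENNReal.ofReal
      (∫ z, M.arrivalTerm π s M.full (fun _ _ => 1) (fun _ _ _ => 1) k z ∂M.noiseLaw) := by
    intro k
    have : M.arrivalTerm π s M.full (fun _ _ => 1) (fun _ _ _ => 1) k =
        {z | arrival s z k ≤ M.T}.indicator 1 := by
      funext z
      simp [arrivalTerm, indicator]
    rw [this, integral_indicator_one (hmeas k), ofReal_measureReal]
  have hbc : ∀ᵐ z ∂M.noiseLaw, ∀ᶠ k in Filter.atTop, z ∉ {z | arrival s z k ≤ M.T} := by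
    refine ae_eventually_notMem ?_
    simp_rw [he]
    exact hsum.tsum_ofReal_ne_top
  filter_upwards [ae_pos_noiseLaw, hbc] with z hz h
  obtain ⟨k, hk⟩ := h.exists
  exact ⟨hz, k, not_le.1 hk⟩

variable {w d : ℝ → M.State → ℝ} {ξ : ℝ → (ℕ → ℝ × ℝ × ℝ) → ℝ}

lemma exists_awaiting {z : ℕ → ℝ × ℝ × ℝ} {t : ℝ} (hst : s < t) {K : ℕ} (hK : t ≤ arrival s z K) :
    ∃ k ≤ K, epoch s z k < t ∧ t ≤ arrival s z k := by
  classical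
  have hex : ∃ k, t ≤ arrival s z k := ⟨K, hK⟩
  refine ⟨Nat.find hex, Nat.find_min' hex hK, ?_, Nat.find_spec hex⟩
  rcases h : Nat.find hex with _ | k
  · simpa [epoch] using hst
  · exact not_le.1 (Nat.find_min hex (h ▸ k.lt_succ_self))

lemma measurable_jump (hwc : ∀ y, Continuous fun t => w t y) (y : M.State) (o : Option (Fin n)) :
    Measurable fun t => M.jump w t y o := by
  unfold jump
  exact (((hwc _).sub (hwc _)).add continuous_const).measurable

lemma exists_abs_jump_le (hwc : ∀ y, Continuous fun t => w t y) :
    ∃ C, ∀ t ∈ Icc 0 M.T, ∀ y o, |M.jump w t y o| ≤ C := by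
  obtain ⟨C, -, hC⟩ := exists_abs_le (M := M) (g := fun t y => ∑ o, |M.jump w t y o|) fun y => by
    unfold jump
    exact (continuous_finsetSum _ fun o _ =>
      (((hwc _).sub (hwc _)).add continuous_const).abs).continuousOn
  exact ⟨C, fun t ht y o => (Finset.single_le_sum (f := fun o => |M.jump w t y o|)
    (fun _ _ => abs_nonneg _) (Finset.mem_univ o)).trans ((le_abs_self _).trans (hC t ht y))⟩

/-- For a solution of the backward equation, the path integral is a sum of compensated terms. -/
lemma pathIntegral_eq_tsum (hπ : M.IsAdmissible π) (hs : 0 ≤ s) (hsT : s ≤ M.T)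
    (hwc : ∀ y, Continuous fun t => w t y) (hw : ∀ t y, M.drift π w d t y = 0)
    (hξ : IsNonanticipating s ξ) {z : ℕ → ℝ × ℝ × ℝ} (hz : IsRegular M.T s z) :
    M.pathIntegral π s x z w d (fun t => ξ t z) =
      ∑' k, (M.arrivalTerm π s x ξ (M.jump w) k z - M.compensator π s x ξ (M.jump w) k z) := by
  obtain ⟨K, hK⟩ := hz.exists_lt
  have hmono := strictMono_arrival (s := s) hz.pos
  obtain ⟨C₁, hC₁⟩ := hξ.bounded
  have hφ := measurable_jump (M := M) hwc
  have hF : ∀ k, K < k → M.arrivalTerm π s x ξ (M.jump w) k z = 0 := fun k hk =>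
    if_neg (not_le.2 (hK.trans (hmono hk)))
  have hG : ∀ k, K < k → M.compensator π s x ξ (M.jump w) k z = 0 := by
    intro k hk
    rw [compensator, setIntegral_congr_fun (g := fun _ => 0) measurableSet_Ioc fun t ht => ?_]
    · simp
    · refine if_neg fun h => absurd h.1 (not_lt.2 ?_)
      exact ht.2.trans (hK.le.trans ((strictMono_epoch hz.pos).monotone (Nat.succ_le_of_lt hk)))
  rw [tsum_eq_sum (s := Finset.range (K + 1)) fun k hk => by
    have : K < k := by simpa [Nat.lt_succ_iff] using hk
    rw [hF k this, hG k this, sub_zero], Finset.sum_sub_distrib]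
  rw [pathIntegral, tsum_eq_sum (s := Finset.range (K + 1)) fun k hk => by
    have : K < k := by simpa [Nat.lt_succ_iff] using hk
    exact hF k this]
  rw [sub_eq_add_neg]
  congr 1
  obtain ⟨C₂, hjump⟩ := exists_abs_jump_le (M := M) hwc
  have hint : ∀ k, IntegrableOn (fun t => if epoch s z k < t ∧ t ≤ arrival s z k then
      ξ t z * M.meanChoice π t (M.stock π s x z k) (M.jump w t (M.stock π s x z k)) else 0)
      (Ioc s M.T) := by
    intro k
    have hm := (measurable_compensator_integrand (x := x) hπ hξ hφ k).comp
      (measurable_prodMk_left (x := z))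
    refine Integrable.of_bound hm.aestronglyMeasurable (C₁ * C₂) ?_
    filter_upwards [ae_restrict_mem measurableSet_Ioc] with t ht
    have htI : t ∈ Icc 0 M.T := ⟨hs.trans ht.1.le, ht.2⟩
    simp only [Real.norm_eq_abs]
    split_ifs
    · rw [abs_mul]
      exact mul_le_mul (hC₁ _ _) (abs_meanChoice_le hπ fun o => hjump t htI _ o)
        (abs_nonneg _) ((abs_nonneg _).trans (hC₁ 0 z))
    · simpa using mul_nonneg ((abs_nonneg _).trans (hC₁ 0 z))
        ((abs_nonneg _).trans (hjump t htI M.full none))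
  simp only [compensator]
  rw [← Finset.mul_sum, ← integral_finsetSum _ fun k _ => hint k, ← integral_const_mul,
    ← integral_neg, intervalIntegral.integral_of_le hsT]
  refine setIntegral_congr_fun measurableSet_Ioc fun t ht => ?_
  -- exactly one customer is awaited at time `t`
  obtain ⟨k, hkK, hk1, hk2⟩ := exists_awaiting ht.1 (ht.2.trans hK.le)
  have hsingle : ∑ i ∈ Finset.range (K + 1), (if epoch s z i < t ∧ t ≤ arrival s z i then
      ξ t z * M.meanChoice π t (M.stock π s x z i) (M.jump w t (M.stock π s x z i)) else 0) =
      ξ t z * M.meanChoice π t (M.stock π s x z k) (M.jump w t (M.stock π s x z k)) := by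
    rw [Finset.sum_eq_single k, if_pos ⟨hk1, hk2⟩]
    · intro i _ hik
      refine if_neg fun h => hik ?_
      rw [← ncard_arrival_lt hz.pos h.1 h.2, ← ncard_arrival_lt hz.pos hk1 hk2]
    · exact fun h => absurd (Finset.mem_range.2 (Nat.lt_succ_of_le hkK)) h
  simp only [hsingle, stateLeft_eq_stock hz.pos hk1 hk2]
  have h0 := hw t (M.stock π s x z k)
  have h1 : M.meanChoice π t (M.stock π s x z k) (M.jump w t (M.stock π s x z k)) =
    M.meanChoice π t (M.stock π s x z k) fun o => w t (M.next (M.stock π s x z k) o) -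
      w t (M.stock π s x z k) + M.gain o := rfl
  rw [drift, ← h1] at h0
  linear_combination ξ t z * h0

/-- Dynkin's formula: against a nonanticipating test process, the path integral of a solution of the
backward equation has mean zero. -/
theorem integral_pathIntegral_eq_zero (hπ : M.IsAdmissible π) (hs : 0 ≤ s) (hsT : s ≤ M.T)
    (hwc : ∀ y, Continuous fun t => w t y) (hw : ∀ t y, M.drift π w d t y = 0)
    (hξ : IsNonanticipating s ξ) :
    Integrable (fun z => M.pathIntegral π s x z w d fun t => ξ t z) M.noiseLaw ∧
      ∫ z, M.pathIntegral π s x z w d (fun t => ξ t z) ∂M.noiseLaw = 0 := by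
  obtain ⟨C₁, hC₁⟩ := hξ.bounded
  have hφ := measurable_jump (M := M) hwc
  obtain ⟨C₂, hjump⟩ := exists_abs_jump_le (M := M) hwc
  have h1 : ∀ t ∈ Icc 0 M.T, ∀ (y : M.State) (o : Option (Fin n)), |(1 : ℝ)| ≤ 1 := by simp
  have hm : ∀ (y : M.State) (o : Option (Fin n)), Measurable fun _ : ℝ => (1 : ℝ) :=
    fun _ _ => measurable_const
  have hiF := integrable_arrivalTerm (x := x) hπ hs hξ hφ hjump
  have hiG := integrable_compensator (x := x) hπ hs hsT hξ hφ hjump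
  have hiF1 := integrable_arrivalTerm (x := x) hπ hs (isNonanticipating_one s) hm h1
  have hiG1 := integrable_compensator (x := x) hπ hs hsT (isNonanticipating_one s) hm h1
  have hi : ∀ k, Integrable (fun z => M.arrivalTerm π s x ξ (M.jump w) k z -
      M.compensator π s x ξ (M.jump w) k z) M.noiseLaw := fun k => (hiF k).sub (hiG k)
  have hsum : Summable fun k => ∫ z, ‖M.arrivalTerm π s x ξ (M.jump w) k z -
      M.compensator π s x ξ (M.jump w) k z‖ ∂M.noiseLaw := by
    refine Summable.of_nonneg_of_le (fun k => integral_nonneg fun z => norm_nonneg _) (fun k => ?_)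
      ((summable_integral_arrivalTerm_one (x := x) hπ hs hsT).mul_left (2 * (C₁ * C₂)))
    have hF1 : ∫ z, M.arrivalTerm π s x (fun _ _ => 1) (fun _ _ _ => 1) k z ∂M.noiseLaw =
      ∫ z, M.compensator π s x (fun _ _ => 1) (fun _ _ _ => 1) k z ∂M.noiseLaw :=
      integral_arrivalTerm hπ hs hsT (isNonanticipating_one s) hm h1 k
    calc _ ≤ ∫ z, (C₁ * C₂ * M.arrivalTerm π s x (fun _ _ => 1) (fun _ _ _ => 1) k z +
          C₁ * C₂ * M.compensator π s x (fun _ _ => 1) (fun _ _ _ => 1) k z) ∂M.noiseLaw := by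
          refine integral_mono_ae (hi k).norm
            (((hiF1 k).const_mul _).add ((hiG1 k).const_mul _)) ?_
          filter_upwards [ae_pos_noiseLaw] with z hz
          exact (abs_sub _ _).trans (add_le_add (abs_arrivalTerm_le hs hC₁ hjump k hz)
            (abs_compensator_le hπ hs hC₁ hjump k z))
      _ = _ := by
          rw [integral_add ((hiF1 k).const_mul _) ((hiG1 k).const_mul _), integral_const_mul,
            integral_const_mul, ← hF1]
          ring
  have hae : (fun z => M.pathIntegral π s x z w d fun t => ξ t z) =ᵐ[M.noiseLaw] fun z =>
      ∑' k, (M.arrivalTerm π s x ξ (M.jump w) k z - M.compensator π s x ξ (M.jump w) k z) := by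
    filter_upwards [ae_isRegular hπ hs hsT] with z hz
    exact pathIntegral_eq_tsum hπ hs hsT hwc hw hξ hz
  refine ⟨(integrable_tsum_of_summable_integral_norm hi hsum).congr hae.symm, ?_⟩
  rw [integral_congr_ae hae, ← integral_tsum_of_summable_integral_norm hi hsum]
  have : ∀ k, ∫ z, (M.arrivalTerm π s x ξ (M.jump w) k z -
      M.compensator π s x ξ (M.jump w) k z) ∂M.noiseLaw = 0 := fun k => by
    rw [integral_sub (hiF k) (hiG k), integral_arrivalTerm hπ hs hsT hξ hφ hjump k, sub_self]
  simp [this]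

end RevenueModel

/-! ### Predictable test processes as functions of the marks -/

namespace RevenueModel

variable {m n : ℕ} {M : RevenueModel m n} {π : M.Policy}

/-- The filtration generated by the inventory process on the space of marks. -/
def canonicalFiltration (M : RevenueModel m n) (π : M.Policy) :
    Filtration ℝ≥0 (⊤ : MeasurableSpace (ℕ → ℝ × ℝ × ℝ)) :=
  generatedFiltration fun t z => M.state π 0 M.full z t

lemma stateFiltration_eq_comap {Ω : Type*} (Z : ℕ → Ω → ℝ × ℝ × ℝ) (t : ℝ≥0) :
    M.stateFiltration π Z t =
      MeasurableSpace.comap (fun ω k => Z k ω) (M.canonicalFiltration π t) := by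
  change (⨆ s : Iic t, MeasurableSpace.comap (fun ω => M.X π Z s ω) ⊤) =
    MeasurableSpace.comap _ (⨆ s : Iic t, MeasurableSpace.comap
      (fun z => M.state π 0 M.full z s) ⊤)
  rw [MeasurableSpace.comap_iSup]
  simp only [MeasurableSpace.comap_comp]
  rfl

lemma predictable_le_comap {Ω : Type*} (Z : ℕ → Ω → ℝ × ℝ × ℝ) :
    (M.stateFiltration π Z).predictable ≤
      MeasurableSpace.comap (fun p : ℝ≥0 × Ω => (p.1, fun k => Z k p.2))
        (M.canonicalFiltration π).predictable := by
  refine measurableSpace_le_predictable_of_measurableSet (fun A hA => ?_) fun t A hA => ?_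
  · rw [stateFiltration_eq_comap] at hA
    obtain ⟨B, hB, rfl⟩ := hA
    exact ⟨_, measurableSet_predictable_singleton_bot_prod hB, rfl⟩
  · rw [stateFiltration_eq_comap] at hA
    obtain ⟨B, hB, rfl⟩ := hA
    exact ⟨_, measurableSet_predictable_Ioi_prod hB, rfl⟩

lemma canonicalFiltration_le (hπ : M.IsAdmissible π) (t : ℝ≥0) :
    M.canonicalFiltration π t ≤ MeasurableSpace.pi := by
  refine iSup_le fun s => ?_
  rintro _ ⟨B, -, rfl⟩
  exact ((measurable_state hπ 0 M.full).comp measurable_prodMk_left) B.to_countable.measurableSet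

lemma canonicalFiltration_predictable_le (hπ : M.IsAdmissible π) :
    (M.canonicalFiltration π).predictable ≤
      (inferInstance : MeasurableSpace (ℝ≥0 × (ℕ → ℝ × ℝ × ℝ))) :=
  measurableSpace_le_predictable_of_measurableSet
    (fun A hA => (measurableSet_singleton _).prod (canonicalFiltration_le hπ _ A hA))
    fun t A hA => measurableSet_Ioi.prod (canonicalFiltration_le hπ t A hA)

/-- Predictable sets do not distinguish paths of the inventory process that agree before `t`. -/
lemma mem_predictable_iff {S : Set (ℝ≥0 × (ℕ → ℝ × ℝ × ℝ))}
    (hS : MeasurableSet[(M.canonicalFiltration π).predictable] S) {t : ℝ≥0} (ht : 0 < t)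
    {z z' : ℕ → ℝ × ℝ × ℝ}
    (h : ∀ r < t, M.state π 0 M.full z r = M.state π 0 M.full z' r) :
    (t, z) ∈ S ↔ (t, z') ∈ S := by
  -- the sets that do not distinguish two given points form a σ-algebra
  have inv : ∀ {β : Type} (b b' : β) (A : Set β),
      MeasurableSet[MeasurableSpace.map (fun i : Bool => if i then b else b') ⊥] A ↔
        (b ∈ A ↔ b' ∈ A) := by
    intro β b b' A
    rw [MeasurableSpace.map_def, MeasurableSpace.measurableSet_bot_iff]
    constructor
    · rintro (h | h)
      · have h1 : (true : Bool) ∉ (∅ : Set Bool) := notMem_empty _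
        have h2 : (false : Bool) ∉ (∅ : Set Bool) := notMem_empty _
        rw [← h] at h1 h2
        simp only [mem_preimage] at h1 h2
        exact iff_of_false h1 h2
      · have h1 : (true : Bool) ∈ (univ : Set Bool) := mem_univ _
        have h2 : (false : Bool) ∈ (univ : Set Bool) := mem_univ _
        rw [← h] at h1 h2
        simp only [mem_preimage] at h1 h2
        exact iff_of_true h1 h2
    · intro h
      by_cases hb : b ∈ A
      · refine Or.inr (eq_univ_of_forall fun i => ?_)
        cases i
        · exact h.1 hb
        · exact hb
      · refine Or.inl (eq_empty_of_forall_notMem fun i => ?_)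
        cases i
        · exact fun h' => hb (h.2 h')
        · exact hb
  have hfil : ∀ r < t, ∀ A, MeasurableSet[M.canonicalFiltration π r] A → (z ∈ A ↔ z' ∈ A) := by
    intro r hr A hA
    rw [← inv]
    refine (iSup_le fun s => ?_ : M.canonicalFiltration π r ≤ _) A hA
    rintro _ ⟨B, -, rfl⟩
    rw [inv]
    change M.state π 0 M.full z (s : ℝ≥0) ∈ B ↔ M.state π 0 M.full z' (s : ℝ≥0) ∈ B
    rw [h s (lt_of_le_of_lt s.2 hr)]
  rw [← inv]
  refine (measurableSpace_le_predictable_of_measurableSet (fun A _ => ?_) fun r A hA => ?_ :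
    (M.canonicalFiltration π).predictable ≤ _) S hS
  · rw [inv]
    exact iff_of_false (fun h' => ht.ne' h'.1) fun h' => ht.ne' h'.1
  · rw [inv]
    simp only [mem_prod, mem_Ioi]
    exact and_congr_right fun hr => hfil r hr A hA

lemma state_congr_of_lt {s : ℝ} {x : M.State} {k : ℕ} {z z' : ℕ → ℝ × ℝ × ℝ}
    (hz : ∀ i, 0 < (z i).1) (hz' : ∀ i, 0 < (z' i).1) (h : ∀ i < k, z i = z' i) {r : ℝ}
    (h1 : r < arrival s z k) (h2 : r < arrival s z' k) :
    M.state π s x z r = M.state π s x z' r := by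
  have hset : {i | arrival s z i ≤ r} = {i | arrival s z' i ≤ r} := by
    ext i
    simp only [mem_ofPred_eq]
    rcases lt_or_ge i k with hi | hi
    · have : arrival s z i = arrival s z' i := epoch_congr (i + 1) fun j hj => h j (by omega)
      rw [this]
    · exact iff_of_false (not_le.2 (h1.trans_le ((strictMono_arrival hz).monotone hi)))
        (not_le.2 (h2.trans_le ((strictMono_arrival hz').monotone hi)))
  have hcard : {i | arrival s z' i ≤ r}.ncard ≤ k := by
    have hsub : {i | arrival s z' i ≤ r} ⊆ Finset.range k := by
      intro i hi
      by_contra hik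
      have hik : k ≤ i := by simpa using hik
      exact absurd (h2.trans_le ((strictMono_arrival hz').monotone hik)) (not_lt.2 hi)
    exact (ncard_le_ncard hsub (Finset.finite_toSet _)).trans (by rw [ncard_coe_finset]; simp)
  rw [state, state, sales, sales, hset, salesTo_congr _ fun i hi => h i (hi.trans_le hcard)]

/-- A bounded process that is predictable for the inventory process is a nonanticipating function of
the marks. -/
lemma IsTestFunction.exists_isNonanticipating (hπ : M.IsAdmissible π) {Ω : Type*}
    {Z : ℕ → Ω → ℝ × ℝ × ℝ} {ξ : ℝ≥0 → Ω → ℝ}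
    (hξ : M.IsTestFunction π Z ξ) :
    ∃ η : ℝ → (ℕ → ℝ × ℝ × ℝ) → ℝ, IsNonanticipating 0 η ∧
      ∀ t ω, ξ t.toNNReal ω = η t fun k => Z k ω := by
  obtain ⟨C, hC⟩ := hξ.bounded
  have hmeas := (hξ.predictable.mono (predictable_le_comap (M := M) (π := π) Z))
  obtain ⟨h, hh, hfac⟩ := StronglyMeasurable.exists_eq_measurable_comp
    (mY := (M.canonicalFiltration π).predictable) hmeas
  have hh' : Measurable h := hh.measurable.mono (canonicalFiltration_predictable_le hπ) le_rfl
  -- truncation makes the factor bounded everywhere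
  refine ⟨fun t z => max (-C) (min C (h (t.toNNReal, z))), ⟨?_, ⟨|C|, fun t z => ?_⟩, ?_⟩,
    fun t ω => ?_⟩
  · exact measurable_const.max (measurable_const.min
      (hh'.comp ((measurable_real_toNNReal.comp measurable_fst).prodMk measurable_snd)))
  · rw [abs_le]
    refine ⟨le_max_of_le_left (neg_le_neg (le_abs_self C)), max_le (neg_le_abs C) ?_⟩
    exact (min_le_left _ _).trans (le_abs_self C)
  · intro k z z' hz hz' hzz t h1 h2 h3
    have ht : 0 < t := (le_epoch hz k).trans_lt h1
    have hst : ∀ r < t.toNNReal, M.state π 0 M.full z r = M.state π 0 M.full z' r := by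
      intro r hr
      have hr' : (r : ℝ) < t := Real.lt_toNNReal_iff_coe_lt.1 hr
      exact state_congr_of_lt hz hz' hzz (hr'.trans_le h2) (hr'.trans_le h3)
    have := (mem_predictable_iff (hh.measurable (measurableSet_singleton (h (t.toNNReal, z))))
      (Real.toNNReal_pos.2 ht) hst).1 rfl
    rw [show h (t.toNNReal, z') = h (t.toNNReal, z) from this]
  · have e : ξ t.toNNReal ω = h (t.toNNReal, fun k => Z k ω) := congrFun hfac (t.toNNReal, ω)
    have hb := abs_le.1 (hC t.toNNReal ω)
    rw [e] at hb ⊢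
    change _ = max (-C) (min C (h (t.toNNReal, fun k => Z k ω)))
    rw [min_eq_right hb.2, max_eq_right hb.1]

/-- The process `1_{r > t} 1_{X_t = x}` is a test process. -/
lemma isTestFunction_indicator {Ω : Type*} {Z : ℕ → Ω → ℝ × ℝ × ℝ} (t : ℝ≥0)
    (x : M.State) :
    M.IsTestFunction π Z fun r ω =>
      (Ioi t ×ˢ {ω | M.X π Z t ω = x}).indicator (fun _ => (1 : ℝ)) (r, ω) := by
  have hA : MeasurableSet[M.stateFiltration π Z t] {ω | M.X π Z t ω = x} :=
    le_iSup (fun s : Iic t => MeasurableSpace.comap (fun ω => M.X π Z s ω) ⊤) ⟨t, self_mem_Iic⟩ _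
      ⟨{x}, trivial, rfl⟩
  refine ⟨?_, 1, fun r ω => ?_⟩
  · exact StronglyMeasurable.indicator stronglyMeasurable_const
      (measurableSet_predictable_Ioi_prod hA)
  · by_cases h : (r, ω) ∈ Ioi t ×ˢ {ω | M.X π Z t ω = x} <;> simp [h]

end RevenueModel

/-! ### From the space of marks to an arbitrary probability space -/

lemma stieltjesIntegral_congr {T : ℝ} (hT : 0 ≤ T) (f : ℝ → ℝ) {g g' : ℝ → ℝ}
    (h : ∀ t ∈ Icc 0 T, g t = g' t) : stieltjesIntegral T hT f g = stieltjesIntegral T hT f g' := by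
  have e : (fun t => g (projIcc 0 T hT t)) = fun t => g' (projIcc 0 T hT t) :=
    funext fun t => h _ (projIcc 0 T hT t).2
  unfold stieltjesIntegral
  rw [e]

namespace RevenueModel

variable {m n : ℕ} {M : RevenueModel m n} {π : M.Policy}

lemma HasTimeDeriv.of_contDiffOn {v : ℝ → M.State → ℝ}
    (hv : ∀ x, ContDiffOn ℝ 1 (fun t => v t x) (Icc 0 M.T)) :
    M.HasTimeDeriv v fun t x => derivWithin (fun t => v t x) (Icc 0 M.T) (M.clock t) := by
  have hcont : ∀ y, Continuous fun t : ℝ =>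
      derivWithin (fun t => v t y) (Icc 0 M.T) (M.clock t) := fun y =>
    ((hv y).continuousOn_derivWithin (uniqueDiffOn_Icc M.T_pos) le_rfl).comp_continuous
      (continuous_subtype_val.comp continuous_clock) fun t => (M.clock t).2
  refine ⟨hcont, fun y a ha b hb => ?_⟩
  have hsub : uIcc a b ⊆ Icc 0 M.T := uIcc_subset_Icc ha hb
  refine (intervalIntegral.integral_eq_sub_of_hasDeriv_right
    ((hv y).continuousOn.mono hsub) (fun t ht => ?_) ((hcont y).intervalIntegrable _ _)).symm
  have htI : t ∈ Icc 0 M.T := hsub (Ioo_subset_Icc_self ht)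
  have hnhds : Icc 0 M.T ∈ nhds t := Icc_mem_nhds
    (lt_of_le_of_lt (le_min ha.1 hb.1) ht.1) (lt_of_lt_of_le ht.2 (max_le ha.2 hb.2))
  rw [clock_of_mem htI]
  exact ((((hv y).differentiableOn one_ne_zero) t htI).hasDerivWithinAt.hasDerivAt
    hnhds).hasDerivWithinAt

lemma HasTimeDeriv.continuousOn {v d : ℝ → M.State → ℝ} (hv : M.HasTimeDeriv v d) (y : M.State) :
    ContinuousOn (fun t => v t y) (Icc 0 M.T) := by
  have h0 : (0 : ℝ) ∈ Icc 0 M.T := ⟨le_rfl, M.T_pos.le⟩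
  have : ContinuousOn (fun t => v 0 y + ∫ r in (0)..t, d r y) (Icc 0 M.T) :=
    (continuous_const.add (intervalIntegral.continuous_primitive
      (fun a b => (hv.continuous y).intervalIntegrable a b) 0)).continuousOn
  refine this.congr fun t ht => ?_
  change v t y = v 0 y + ∫ r in (0)..t, d r y
  rw [← hv.sub_eq y 0 h0 t ht]
  ring

variable {Ω : Type*} [MeasurableSpace Ω] {μ : Measure Ω} {Z : ℕ → Ω → ℝ × ℝ × ℝ}

lemma IsDrivingNoise.measurePreserving (hZ : M.IsDrivingNoise μ Z) :
    MeasurePreserving (fun ω k => Z k ω) μ M.noiseLaw := by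
  refine ⟨measurable_pi_lambda _ hZ.measurable, ?_⟩
  rw [hZ.indep.map_fun_eq_infinitePi_map hZ.measurable, noiseLaw]
  congr 1
  exact funext hZ.law

lemma IsDrivingNoise.ae_isRegular (hZ : M.IsDrivingNoise μ Z) (hπ : M.IsAdmissible π) {s : ℝ}
    (hs : 0 ≤ s) (hsT : s ≤ M.T) : ∀ᵐ ω ∂μ, IsRegular M.T s fun k => Z k ω :=
  hZ.measurePreserving.quasiMeasurePreserving.ae (RevenueModel.ae_isRegular hπ hs hsT)

lemma measurableSet_X_eq (hZ : M.IsDrivingNoise μ Z) (hπ : M.IsAdmissible π) (t : ℝ)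
    (x : M.State) : MeasurableSet {ω | M.X π Z t ω = x} :=
  (((measurable_state hπ 0 M.full).comp measurable_prodMk_left).comp
    hZ.measurePreserving.measurable) (measurableSet_singleton x)

lemma integral_pathIntegral_comp (hZ : M.IsDrivingNoise μ Z) (hπ : M.IsAdmissible π) {s : ℝ}
    (hs : 0 ≤ s) (hsT : s ≤ M.T) {x : M.State} {w d : ℝ → M.State → ℝ}
    (hwc : ∀ y, Continuous fun t => w t y) (hw : ∀ t y, M.drift π w d t y = 0)
    {η : ℝ → (ℕ → ℝ × ℝ × ℝ) → ℝ} (hη : IsNonanticipating s η) :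
    Integrable (fun ω => M.pathIntegral π s x (fun k => Z k ω) w d
        fun t => η t fun k => Z k ω) μ ∧
      ∫ ω, M.pathIntegral π s x (fun k => Z k ω) w d (fun t => η t fun k => Z k ω) ∂μ = 0 := by
  obtain ⟨hi, h0⟩ := integral_pathIntegral_eq_zero (x := x) hπ hs hsT hwc hw hη
  have hmp := hZ.measurePreserving
  refine ⟨hmp.integrable_comp_of_integrable hi, ?_⟩
  rw [← h0, ← hmp.map_eq, integral_map hmp.measurable.aemeasurable
    (by rw [hmp.map_eq]; exact hi.aestronglyMeasurable)]

/-! ### The value function and the orthogonality condition -/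

/-- The value function solves the backward equation: Dynkin's formula for the test process `1` on
`(t, T]`. -/
lemma J_eq [IsProbabilityMeasure μ] (hZ : M.IsDrivingNoise μ Z) (hπ : M.IsAdmissible π)
    {w d : ℝ → M.State → ℝ} (hwc : ∀ y, Continuous fun t => w t y) (hwd : M.HasTimeDeriv w d)
    (hwT : ∀ y, w M.T y = 0) (hw : ∀ t y, M.drift π w d t y = 0) {t : ℝ} (ht : t ∈ Icc 0 M.T)
    (x : M.State) : M.J μ Z π t x = w t x := by
  have hη : IsNonanticipating t fun r (_ : ℕ → ℝ × ℝ × ℝ) => if t < r then (1 : ℝ) else 0 :=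
    ⟨Measurable.ite (measurableSet_lt measurable_const measurable_fst) measurable_const
      measurable_const, ⟨1, fun r z => by split_ifs <;> simp⟩, fun _ _ _ _ _ _ _ _ _ _ => rfl⟩
  obtain ⟨hi, h0⟩ := integral_pathIntegral_comp (x := x) hZ hπ ht.1 ht.2 hwc hw hη
  have hae : (fun ω => M.pathIntegral π t x (fun k => Z k ω) w d
      fun r => if t < r then (1 : ℝ) else 0) =ᵐ[μ]
      fun ω => M.rewardToGo π t x (fun k => Z k ω) t - w t x := by
    filter_upwards [hZ.ae_isRegular hπ ht.1 ht.2] with ω hω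
    have hx : M.state π t x (fun k => Z k ω) t = x := by
      have hn : {k | arrival t (fun k => Z k ω) k ≤ t}.ncard = 0 :=
        ncard_arrival_le hω.pos (by simp) (lt_arrival hω.pos 0)
      rw [state, sales, hn]
      exact stock_zero
    rw [pathIntegral_indicator hπ hwd ht.1 hω ⟨le_rfl, ht.2⟩, hx, hwT]
    ring
  have hint := hi.congr hae
  rw [integral_congr_ae hae] at h0
  have hr : Integrable (fun ω => M.rewardToGo π t x (fun k => Z k ω) t) μ :=
    (hint.add (integrable_const (w t x))).congr (ae_of_all _ fun ω => sub_add_cancel _ _)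
  rw [integral_sub hr (integrable_const _)] at h0
  simp only [integral_const, probReal_univ, one_smul] at h0
  exact sub_eq_zero.1 h0

lemma tdIntegral_ae_eq (hZ : M.IsDrivingNoise μ Z) (hπ : M.IsAdmissible π)
    {v d : ℝ → M.State → ℝ} (hv : M.HasTimeDeriv v d) {η : ℝ → (ℕ → ℝ × ℝ × ℝ) → ℝ}
    (hη : IsNonanticipating 0 η) :
    (fun ω => M.tdIntegral π 0 M.full (fun k => Z k ω) v fun t => η t fun k => Z k ω) =ᵐ[μ]
      fun ω => M.pathIntegral π 0 M.full (fun k => Z k ω) v d fun t => η t fun k => Z k ω := by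
  obtain ⟨C, hC⟩ := hη.bounded
  filter_upwards [hZ.ae_isRegular hπ le_rfl M.T_pos.le] with ω hω
  exact tdIntegral_eq_pathIntegral hπ hv hω (hη.measurable.comp measurable_prodMk_right)
    fun t => hC t _

lemma isOrthogonal_of_drift_eq_zero (hZ : M.IsDrivingNoise μ Z) (hπ : M.IsAdmissible π)
    {w d : ℝ → M.State → ℝ} (hwc : ∀ y, Continuous fun t => w t y) (hwd : M.HasTimeDeriv w d)
    (hw : ∀ t y, M.drift π w d t y = 0) : M.IsOrthogonal μ Z π w := by
  intro ξ hξ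
  obtain ⟨η, hη, hξη⟩ := hξ.exists_isNonanticipating hπ
  simp only [hξη]
  obtain ⟨hi, h0⟩ := integral_pathIntegral_comp (x := M.full) hZ hπ le_rfl M.T_pos.le hwc hw hη
  have hae := tdIntegral_ae_eq hZ hπ hwd hη
  exact ⟨hi.congr hae.symm, (integral_congr_ae hae).trans h0⟩

/-- Testing the orthogonality condition against `1_{r > t} 1_{X_t = x}`. -/
lemma IsOrthogonal.setIntegral_rewardToGo [IsProbabilityMeasure μ] (hZ : M.IsDrivingNoise μ Z)
    (hπ : M.IsAdmissible π) {v d : ℝ → M.State → ℝ} (hv : M.HasTimeDeriv v d)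
    (hvT : ∀ y, v M.T y = 0) (ho : M.IsOrthogonal μ Z π v) {t : ℝ} (ht : t ∈ Icc 0 M.T)
    (x : M.State) :
    ∫ ω in {ω | M.X π Z t ω = x}, M.rewardToGo π 0 M.full (fun k => Z k ω) t ∂μ =
      v t x * μ.real {ω | M.X π Z t ω = x} := by
  obtain ⟨hi, h0⟩ := ho _ (isTestFunction_indicator t.toNNReal x)
  have hA := measurableSet_X_eq hZ hπ t x
  set A := {ω | M.X π Z t ω = x} with hAdef
  have hcoe : ((t.toNNReal : ℝ≥0) : ℝ) = t := Real.coe_toNNReal t ht.1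
  rw [hcoe] at hi h0
  have hae : (fun ω => M.tdIntegral π 0 M.full (fun k => Z k ω) v fun r =>
      (Ioi t.toNNReal ×ˢ A).indicator (fun _ => (1 : ℝ)) (r.toNNReal, ω)) =ᵐ[μ]
      A.indicator fun ω => M.rewardToGo π 0 M.full (fun k => Z k ω) t - v t x := by
    filter_upwards [hZ.ae_isRegular hπ le_rfl M.T_pos.le] with ω hω
    have hξ : (fun r : ℝ => (Ioi t.toNNReal ×ˢ A).indicator (fun _ => (1 : ℝ)) (r.toNNReal, ω)) =
        fun r => if t < r then A.indicator (fun _ => (1 : ℝ)) ω else 0 := by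
      classical
      funext r
      have : t.toNNReal < r.toNNReal ↔ t < r := by
        rw [Real.lt_toNNReal_iff_coe_lt, hcoe]
      simp only [indicator_apply, mem_prod, mem_Ioi, this]
      split_ifs <;> simp_all
    have hm : Measurable fun r => if t < r then A.indicator (fun _ => (1 : ℝ)) ω else 0 :=
      Measurable.ite measurableSet_Ioi measurable_const measurable_const
    rw [hξ, tdIntegral_eq_pathIntegral hπ hv hω hm (C := 1)
      (fun r => by by_cases h : ω ∈ A <;> split_ifs <;> simp [h]),
      pathIntegral_indicator hπ hv le_rfl hω ht, hvT]
    by_cases h : ω ∈ A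
    · have hx : M.state π 0 M.full (fun k => Z k ω) t = x := h
      rw [indicator_of_mem h, indicator_of_mem h, hx]
      ring
    · rw [indicator_of_notMem h, indicator_of_notMem h]
      ring
  have hint := (integrable_indicator_iff hA).1 (hi.congr hae)
  rw [integral_congr_ae hae, integral_indicator hA] at h0
  have hr : IntegrableOn (fun ω => M.rewardToGo π 0 M.full (fun k => Z k ω) t) A μ :=
    (Integrable.add hint (integrable_const (v t x))).congr
      (ae_of_all _ fun ω => sub_add_cancel _ _)
  rw [integral_sub hr (integrable_const _), setIntegral_const, smul_eq_mul] at h0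
  linarith

/-- Two functions that agree at all states visited with positive probability almost surely agree
along the whole path, since the path is right-continuous. -/
lemma ae_apply_X_eq [IsProbabilityMeasure μ] (hZ : M.IsDrivingNoise μ Z) (hπ : M.IsAdmissible π)
    {v w : ℝ → M.State → ℝ} (hv : ∀ y, ContinuousOn (fun t => v t y) (Icc 0 M.T))
    (hw : ∀ y, ContinuousOn (fun t => w t y) (Icc 0 M.T))
    (h : ∀ t ∈ Icc 0 M.T, ∀ x, μ {ω | M.X π Z t ω = x} ≠ 0 → v t x = w t x) :
    ∀ᵐ ω ∂μ, ∀ t ∈ Icc 0 M.T, v t (M.X π Z t ω) = w t (M.X π Z t ω) := by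
  have hfix : ∀ t ∈ Icc 0 M.T, ∀ᵐ ω ∂μ, v t (M.X π Z t ω) = w t (M.X π Z t ω) := by
    intro t ht
    have : ∀ᵐ ω ∂μ, ∀ x, M.X π Z t ω = x → v t x = w t x := by
      refine ae_all_iff.2 fun x => ?_
      by_cases h0 : μ {ω | M.X π Z t ω = x} = 0
      · have : ∀ᵐ ω ∂μ, ¬ M.X π Z t ω = x := by rw [ae_iff]; simpa using h0
        filter_upwards [this] with ω hω hx using absurd hx hω
      · exact Filter.Eventually.of_forall fun _ _ => h t ht x h0
    filter_upwards [this] with ω hω using hω _ rfl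
  have hrat : ∀ᵐ ω ∂μ, ∀ q : ℚ, (q : ℝ) ∈ Icc 0 M.T →
      v q (M.X π Z q ω) = w q (M.X π Z q ω) := by
    refine ae_all_iff.2 fun q => ?_
    by_cases hq : (q : ℝ) ∈ Icc 0 M.T
    · filter_upwards [hfix q hq] with ω hω _ using hω
    · exact Filter.Eventually.of_forall fun _ hq' => absurd hq' hq
  filter_upwards [hrat, hfix M.T ⟨M.T_pos.le, le_rfl⟩, hZ.ae_isRegular hπ le_rfl M.T_pos.le]
    with ω hω hωT hreg t ht
  rcases eq_or_lt_of_le ht.2 with rfl | htT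
  · exact hωT
  obtain ⟨c, hc, hc', -, hlt⟩ := hreg.exists_count ht.2
  set y := M.X π Z t ω with hy
  have hconst : ∀ r, t ≤ r → r < arrival 0 (fun k => Z k ω) c → M.X π Z r ω = y := by
    intro r htr hr
    rw [hy, X, X, state, state, sales, sales, hc,
      ncard_arrival_le hreg.pos (fun i hi => ((hc' i).2 hi).trans htr) hr]
  by_contra hne
  have hev : ∀ᶠ r in nhdsWithin t (Ioi t), v r y ≠ w r y := by
    have h1 := (((hv y).sub (hw y)) t ht).eventually_ne (sub_ne_zero.2 hne)
    have h2 : nhdsWithin t (Ioi t) ≤ nhdsWithin t (Icc 0 M.T) :=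
      nhdsWithin_le_of_mem (Filter.mem_of_superset (Ioo_mem_nhdsGT htT) fun r hr =>
        ⟨ht.1.trans hr.1.le, hr.2.le⟩)
    filter_upwards [h2 h1] with r hr using sub_ne_zero.1 hr
  have hev' := hev.and (Ioo_mem_nhdsGT (lt_min htT hlt))
  obtain ⟨u, hu, hsub⟩ := mem_nhdsGT_iff_exists_Ioo_subset.1 hev'
  obtain ⟨q, hq1, hq2⟩ := exists_rat_btwn (show t < u from hu)
  obtain ⟨hvw, hq3, hq4⟩ := hsub ⟨hq1, hq2⟩
  refine hvw ?_
  have := hω q ⟨ht.1.trans hq3.le, (hq4.trans_le (min_le_left _ _)).le⟩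
  rwa [hconst q hq3.le (hq4.trans_le (min_le_right _ _))] at this

/-- The orthogonality condition only involves `v` along the paths of the inventory process. -/
lemma IsOrthogonal.congr [IsProbabilityMeasure μ] (hZ : M.IsDrivingNoise μ Z)
    (hπ : M.IsAdmissible π) {v w : ℝ → M.State → ℝ}
    (hv : ∀ y, ContinuousOn (fun t => v t y) (Icc 0 M.T))
    (hw : ∀ y, ContinuousOn (fun t => w t y) (Icc 0 M.T)) (ho : M.IsOrthogonal μ Z π w)
    (h : ∀ t ∈ Icc 0 M.T, ∀ x, μ {ω | M.X π Z t ω = x} ≠ 0 → v t x = w t x) :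
    M.IsOrthogonal μ Z π v := by
  intro ξ hξ
  have hae : (fun ω => M.tdIntegral π 0 M.full (fun k => Z k ω) w fun t => ξ t.toNNReal ω) =ᵐ[μ]
      fun ω => M.tdIntegral π 0 M.full (fun k => Z k ω) v fun t => ξ t.toNNReal ω := by
    filter_upwards [ae_apply_X_eq hZ hπ hv hw h] with ω hω
    have := stieltjesIntegral_congr M.T_pos.le (fun t => ξ t.toNNReal ω)
      (g := fun t => w t (M.state π 0 M.full (fun k => Z k ω) t)) fun t ht => (hω t ht).symm
    rw [tdIntegral, this]
    rfl
  obtain ⟨hi, h0⟩ := ho ξ hξ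
  exact ⟨hi.congr hae, (integral_congr_ae hae).symm.trans h0⟩

end RevenueModel

end

theorem theorem2 {m n : ℕ} (M : RevenueModel m n) (π : M.Policy) (hπ : M.IsAdmissible π)
    {Ω : Type*} [MeasurableSpace Ω] (μ : Measure Ω) [IsProbabilityMeasure μ]
    (Z : ℕ → Ω → ℝ × ℝ × ℝ) (hZ : M.IsDrivingNoise μ Z) :
    -- the value function is the conditional expected reward to go of the process started from `c`
    (∀ t ∈ Icc 0 M.T, ∀ x, μ {ω | M.X π Z t ω = x} ≠ 0 →
      M.J μ Z π t x = ∫ ω, M.rewardToGo π 0 M.full (fun k => Z k ω) t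
        ∂(cond μ {ω | M.X π Z t ω = x})) ∧
    ∀ v : ℝ → M.State → ℝ, (∀ x, ContDiffOn ℝ 1 (fun t => v t x) (Icc 0 M.T)) →
      -- `v = J` at all `(t, x)` implies the terminal and the orthogonality condition
      ((∀ t ∈ Icc 0 M.T, ∀ x, v t x = M.J μ Z π t x) →
        (∀ x, v M.T x = 0) ∧ M.IsOrthogonal μ Z π v) ∧
      -- the converse holds at all `(t, x)` if the process visits all states
      ((∀ t ∈ Ioo 0 M.T, ∀ x, μ {ω | M.X π Z t ω = x} ≠ 0) →
        (∀ x, v M.T x = 0) ∧ M.IsOrthogonal μ Z π v →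
        ∀ t ∈ Icc 0 M.T, ∀ x, v t x = M.J μ Z π t x) ∧
      -- in general the equivalence holds on the set of states that are visited
      ((∀ x, v M.T x = 0) ∧ M.IsOrthogonal μ Z π v ↔
        (∀ x, v M.T x = 0) ∧ ∀ t ∈ Icc 0 M.T, ∀ x, μ {ω | M.X π Z t ω = x} ≠ 0 →
          v t x = M.J μ Z π t x) := by
  obtain ⟨w, d, hwc, hwd, hwT, hw⟩ := RevenueModel.exists_backward_solution hπ
  have hJ : ∀ t ∈ Icc 0 M.T, ∀ x, M.J μ Z π t x = w t x := fun t ht x =>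
    RevenueModel.J_eq hZ hπ hwc hwd hwT hw ht x
  have ho : M.IsOrthogonal μ Z π w :=
    RevenueModel.isOrthogonal_of_drift_eq_zero hZ hπ hwc hwd hw
  have hset := fun t (ht : t ∈ Icc 0 M.T) x => ho.setIntegral_rewardToGo hZ hπ hwd hwT ht x
  have hTI : M.T ∈ Icc 0 M.T := ⟨M.T_pos.le, le_rfl⟩
  refine ⟨fun t ht x hx => ?_, fun v hv => ?_⟩
  · rw [hJ t ht x, ProbabilityTheory.cond, integral_smul_measure, hset t ht x, ENNReal.toReal_inv,
      smul_eq_mul, mul_comm (w t x), ← mul_assoc]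
    have : μ.real {ω | M.X π Z t ω = x} ≠ 0 :=
      (ENNReal.toReal_pos hx (measure_ne_top _ _)).ne'
    change _ = (μ.real {ω | M.X π Z t ω = x})⁻¹ * _ * _
    rw [inv_mul_cancel₀ this, one_mul]
  have hvd := RevenueModel.HasTimeDeriv.of_contDiffOn hv
  have hvisited : (∀ x, v M.T x = 0) → M.IsOrthogonal μ Z π v → ∀ t ∈ Icc 0 M.T, ∀ x,
      μ {ω | M.X π Z t ω = x} ≠ 0 → v t x = w t x := by
    intro hvT hvo t ht x hx
    have h1 := hvo.setIntegral_rewardToGo hZ hπ hvd hvT ht x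
    rw [hset t ht x] at h1
    exact (mul_right_cancel₀ (ENNReal.toReal_pos hx (measure_ne_top _ _)).ne' h1).symm
  have hconv : (∀ t ∈ Icc 0 M.T, ∀ x, μ {ω | M.X π Z t ω = x} ≠ 0 → v t x = M.J μ Z π t x) →
      M.IsOrthogonal μ Z π v := fun h =>
    ho.congr hZ hπ hvd.continuousOn hwd.continuousOn fun t ht x hx =>
      (h t ht x hx).trans (hJ t ht x)
  refine ⟨fun h => ⟨fun x => ?_, hconv fun t ht x _ => h t ht x⟩, fun hpos ⟨hvT, hvo⟩ => ?_,
    fun ⟨hvT, hvo⟩ => ⟨hvT, fun t ht x hx => ?_⟩, fun ⟨hvT, h⟩ => ⟨hvT, hconv h⟩⟩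
  · rw [h _ hTI, hJ _ hTI, hwT]
  · intro t ht x
    rw [hJ t ht x]
    -- equality on the open interval extends to its closure
    have hcl : EqOn (fun t => v t x) (fun t => w t x) (Ioo 0 M.T) := fun r hr =>
      hvisited hvT hvo r ⟨hr.1.le, hr.2.le⟩ x (hpos r hr x)
    refine hcl.of_subset_closure (hvd.continuousOn x) (hwd.continuousOn x) Ioo_subset_Icc_self ?_ ht
    rw [closure_Ioo M.T_pos.ne]
  · rw [hJ t ht x]
    exact hvisited hvT hvo t ht x hx
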